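/- Let $n\ge 1$, let $V\subseteq U\subseteq\mathbb{R}^n$ be open, let $X$ be a smooth vector field on $U$, and let $I=(I_1,\dots,I_{n-1})\in C^\infty(U,\mathbb{R}^{n-1})$ be a vector first integral of $\dot x=X(x)$, i.e. $\mathcal{L}_XI_j=\langle\nabla I_j,X\rangle=0$ on $U$ for all $j$, of full rank $n-1$ at every point of $V$. Suppose that $\dot x=X(x)$ has a $T$-periodic orbit $\Gamma=\{\gamma(t):0\le t\le T\}\subset V$ (with $\gamma$ a non-constant $T$-periodic solution, $T>0$) such that * $\Gamma\subset I^{-1}(\{0\})$, and $0\in\mathbb{R}^{n-1}$ is a regular value of $I:V\to\mathbb{R}^{n-1}$; * $\nabla I_1(\gamma(t)),\dots,\nabla I_{n-1}(\gamma(t)),X(\gamma(t))$ are linearly independent for each $0\le t\le T$. For smooth functions $h_1,\dots,h_{n-1}\in C^\infty(V,\mathbb{R})$ define on $V$ the vector field $$\mathbb{X}_0=\mathbb{X}_0^{h}=\Big\|\bigwedge_{i=1}^{n-1}\nabla I_i\Big\|^{-2}\sum_{i=1}^{n-1}(-1)^{n-i}h_iI_i\,\Theta_i,\qquad \Theta_i=\star\Big[\bigwedge_{j\ne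 i}\nabla I_j\wedge\star\Big(\bigwedge_{j=1}^{n-1}\nabla I_j\Big)\Big],$$ where $\star$ is the Hodge star on multivectors of $\mathbb{R}^n$ (canonical metric and orientation, $\alpha\wedge\star\beta=\langle\alpha,\beta\rangle\,e_1\wedge\dots\wedge e_n$), and $\|v_1\wedge\dots\wedge v_{n-1}\|^2$ is the Gram determinant of $v_1,\dots,v_{n-1}$. Let $Y=X+\mathbb{X}_0^{h}$ on $V$. Then: 1. For all smooth $h_1,\dots,h_{n-1}$ on $V$, one has $\mathcal{L}_YI_j=\langle \nabla I_j,Y\rangle=h_jI_j$ on $V$ for every $j$, and $\Gamma$ (with the parametrization $\gamma$) is a $T$-periodic orbit of $\dot x=Y(x)$, $x\in V$. 2. If $\int_0^Th_i(\gamma(s))\,ds<0$ for all $i=1,\dots,n-1$, then $\Gamma$, as a periodic orbit of $\dot x=Y(x)$, $x\in V$, is orbitally phase asymptotically stable with respect to perturbations in $V$. 3. For all smooth $k_1,\dots,k_{n-1}$ on $V$ such that $\int_0^Tk_{i_0}(\gamma(s))\,ds>0$ for some $i_0$, $\Gamma$, as a periodic orbit of $\dot x=X(x)+\mathbb{X}_0^{k}(x)$,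 $x\in V$, is unstable. Here, for a system on $V$, let $x(t;x_0)$ be the solution in $V$ with $x(0;x_0)=x_0$, and let $\operatorname{dist}$ be the Euclidean distance. $\Gamma$ is *orbitally stable* if for every $\varepsilon>0$ there is $\delta>0$ such that for all $x_0\in V$ with $\operatorname{dist}(x_0,\Gamma)<\delta$ the solution exists for all $t\ge0$ and $\operatorname{dist}(x(t;x_0),\Gamma)<\varepsilon$ for all $t>0$; *unstable* if it is not orbitally stable; *orbitally asymptotically stable* if it is orbitally stable and there is $\delta>0$ such that $\operatorname{dist}(x(t;x_0),\Gamma)\to0$ as $t\to\infty$ whenever $x_0\in V$, $\operatorname{dist}(x_0,\Gamma)<\delta$; *orbitally phase asymptotically stable* if it is orbitally asymptotically stable and there is $\delta>0$ such that for every $x_0\in V$ with $\operatorname{dist}(x_0,\Gamma)<\delta$ there is $\theta_0=\theta_0(x_0)$ with $\lim_{t\to\infty}\operatorname{dist}(x(t;x_0),\gamma(t+\theta_0))=0$. -/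

import Mathlib

open scoped ContDiff RealInnerProductSpace Gradient Topology

noncomputable section

namespace PeriodicStab

/-- Euclidean space `ℝⁿ` with its canonical inner product, norm and distance. -/
abbrev Euc (n : ℕ) := EuclideanSpace ℝ (Fin n)

/-! ### Hodge star on the multivectors of `ℝⁿ`

Multivectors are the elements of the exterior algebra, whose product is the wedge product. -/

/-- The volume multivector `e₁ ∧ ⋯ ∧ eₙ` of `ℝⁿ`. -/
def vol (n : ℕ) : ExteriorAlgebra ℝ (Euc n) :=
  ExteriorAlgebra.ιMulti ℝ n (fun i => EuclideanSpace.basisFun (Fin n) ℝ i)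

/-- Interior product `w ↦ v ⌟ w` with the covector `⟪v, ·⟫`: the antiderivation of the exterior
algebra with `v ⌟ u = ⟪v, u⟫` on vectors `u`. It depends linearly on `v`. -/
def interiorProd (n : ℕ) : Euc n →ₗ[ℝ] Module.End ℝ (ExteriorAlgebra ℝ (Euc n)) :=
  (CliffordAlgebra.contractLeft (Q := (0 : QuadraticForm ℝ (Euc n)))).comp (innerₗ (Euc n))

theorem interiorProd_sq (n : ℕ) (v : Euc n) : interiorProd n v * interiorProd n v = 0 := by
  refine LinearMap.ext fun w => ?_
  exact CliffordAlgebra.contractLeft_contractLeft (innerₗ (Euc n) v) w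

/-- The extension of the interior product to multivectors,
`(v₁ ∧ ⋯ ∧ vₖ) ⌟ w = vₖ ⌟ (⋯ ⌟ (v₁ ⌟ w))`. -/
def interiorMul (n : ℕ) :
    ExteriorAlgebra ℝ (Euc n) →ₐ[ℝ] (Module.End ℝ (ExteriorAlgebra ℝ (Euc n)))ᵐᵒᵖ :=
  ExteriorAlgebra.lift ℝ
    ⟨(MulOpposite.opLinearEquiv ℝ).toLinearMap.comp (interiorProd n), fun v => by
      simp only [LinearMap.comp_apply, LinearEquiv.coe_coe, MulOpposite.coe_opLinearEquiv]
      rw [← MulOpposite.op_mul, interiorProd_sq, MulOpposite.op_zero]⟩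

/-- The Hodge star operator of `ℝⁿ` with its canonical metric and orientation, on all multivectors:
`⋆β = β ⌟ (e₁ ∧ ⋯ ∧ eₙ)`. It is the linear map with
`⋆(e_{s₁} ∧ ⋯ ∧ e_{sₖ}) = ± e_{r₁} ∧ ⋯ ∧ e_{rₙ₋ₖ}`, where `r` enumerates the complement of `s` and
`±` is the sign of the permutation `(s, r)`; that is, `α ∧ ⋆β = ⟪α, β⟫ e₁ ∧ ⋯ ∧ eₙ` for `k`-vectors
`α, β`. -/
def hodgeStar (n : ℕ) : ExteriorAlgebra ℝ (Euc n) →ₗ[ℝ] ExteriorAlgebra ℝ (Euc n) :=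
  (LinearMap.applyₗ (vol n)).comp
    ((MulOpposite.opLinearEquiv ℝ).symm.toLinearMap.comp (interiorMul n).toLinearMap)

/-- `⋀_{i} vᵢ`, the wedge product of all the `vᵢ` in increasing order of the index. -/
def wedge {n m : ℕ} (v : Fin m → Euc n) : ExteriorAlgebra ℝ (Euc n) :=
  ExteriorAlgebra.ιMulti ℝ m v

/-- `⋀_{j ≠ i} vⱼ`, the wedge product in increasing order of the index, leaving out `vᵢ`. -/
def wedgeOmit {n m : ℕ} (v : Fin m → Euc n) (i : Fin m) : ExteriorAlgebra ℝ (Euc n) :=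
  (((List.finRange m).filter (fun j => j ≠ i)).map (fun j => ExteriorAlgebra.ι ℝ (v j))).prod

/-- For `n - 1` vectors of `ℝⁿ` (with `n = m + 1`): the `1`-vector
`Θᵢ = ⋆(⋀_{j ≠ i} vⱼ ∧ ⋆(⋀ⱼ vⱼ))`, read as an element of `ℝⁿ`
(`ιInv` is the projection of a multivector to its degree one part). -/
def Theta {m : ℕ} (v : Fin m → Euc (m + 1)) (i : Fin m) : Euc (m + 1) :=
  ExteriorAlgebra.ιInv
    (hodgeStar (m + 1) (wedgeOmit v i * hodgeStar (m + 1) (wedge v)))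

/-! ### The perturbation -/

/-- `∇I₁(u), …, ∇I_m(u)`. -/
def grads {n m : ℕ} (I : Euc n → Euc m) (u : Euc n) (j : Fin m) : Euc n :=
  ∇ (fun x => I x j) u

/-- The perturbation, with `n = m + 1`,
`𝕏₀ = ‖⋀ᵢ ∇Iᵢ‖⁻² ∑_{i=1}^{n-1} (-1)^{n-i} hᵢ Iᵢ Θᵢ`, `Θᵢ = ⋆(⋀_{j ≠ i} ∇Iⱼ ∧ ⋆(⋀ⱼ ∇Iⱼ))`.
The norm is the one of `⋀^{n-1} ℝⁿ`, whose square on a decomposable multivector is the Gram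
determinant. Indices of `Fin m` start at `0`, so that the index called `i` in the formula is
`i + 1` in the code. -/
def perturbation {m : ℕ} (I : Euc (m + 1) → Euc m) (h : Fin m → Euc (m + 1) → ℝ)
    (u : Euc (m + 1)) : Euc (m + 1) :=
  (‖exteriorPower.ιMulti ℝ m (grads I u)‖ ^ 2)⁻¹ •
    ∑ i : Fin m, ((-1 : ℝ) ^ ((m + 1) - ((i : ℕ) + 1)) * h i u * I u i) • Theta (grads I u) i

/-! ### Periodic orbits and their stability -/

/-- `γ` parametrizes a `T`-periodic orbit, contained in `V`, of `ẋ = Y(x)`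
(a non-constant `T`-periodic solution). -/
structure IsPeriodicOrbit {n : ℕ} (Y : Euc n → Euc n) (V : Set (Euc n)) (γ : ℝ → Euc n) (T : ℝ) :
    Prop where
  pos : 0 < T
  mem : ∀ t, γ t ∈ V
  sol : IsIntegralCurve γ (fun _ => Y)
  periodic : Function.Periodic γ T
  nonconst : ∃ t, γ t ≠ γ 0

/-- The orbit `Γ = {γ(t) : 0 ≤ t ≤ T}`. -/
def orbit {n : ℕ} (γ : ℝ → Euc n) (T : ℝ) : Set (Euc n) := γ '' Set.Icc 0 T

/-- `x` is, on `[0, ∞)`, a solution in `V` of the Cauchy problem `ẋ = Y(x)`, `x(0) = x₀`. -/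
structure IsForwardSolution {n : ℕ} (Y : Euc n → Euc n) (V : Set (Euc n)) (x₀ : Euc n)
    (x : ℝ → Euc n) : Prop where
  init : x 0 = x₀
  mem : ∀ t, 0 ≤ t → x t ∈ V
  sol : IsIntegralCurveOn x (fun _ => Y) (Set.Ici 0)

/-- The solution `x(·; x₀)` in `V` of `ẋ = Y(x)`, `x(0) = x₀`, exists for all `t ≥ 0` and has the
property `P`. (The solution is unique on `[0, ∞)` when `Y` is smooth on the open set `V`.) -/
def SolutionHas {n : ℕ} (Y : Euc n → Euc n) (V : Set (Euc n)) (x₀ : Euc n)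
    (P : (ℝ → Euc n) → Prop) : Prop :=
  (∃ x, IsForwardSolution Y V x₀ x) ∧ ∀ x, IsForwardSolution Y V x₀ x → P x

/-- Orbital stability of `Γ`, for the system `ẋ = Y(x)` on `V`. -/
def OrbitallyStable {n : ℕ} (Y : Euc n → Euc n) (V : Set (Euc n)) (Γ : Set (Euc n)) : Prop :=
  ∀ ε > 0, ∃ δ > 0, ∀ x₀ ∈ V, Metric.infDist x₀ Γ < δ →
    SolutionHas Y V x₀ (fun x => ∀ t > 0, Metric.infDist (x t) Γ < ε)

/-- Instability of `Γ`. (If the compact set `Γ` lies in the open set `V`, a solution starting in `V`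
that stays close to `Γ` as long as it exists does exist for all `t ≥ 0`; so the requirement of
global existence in `OrbitallyStable` does not make more orbits unstable.) -/
def Unstable {n : ℕ} (Y : Euc n → Euc n) (V : Set (Euc n)) (Γ : Set (Euc n)) : Prop :=
  ¬ OrbitallyStable Y V Γ

/-- Orbital asymptotic stability of `Γ`. -/
def OrbitallyAsymptoticallyStable {n : ℕ} (Y : Euc n → Euc n) (V : Set (Euc n))
    (Γ : Set (Euc n)) : Prop :=
  OrbitallyStable Y V Γ ∧ ∃ δ > 0, ∀ x₀ ∈ V, Metric.infDist x₀ Γ < δ →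
    SolutionHas Y V x₀
      (fun x => Filter.Tendsto (fun t => Metric.infDist (x t) Γ) Filter.atTop (𝓝 0))

/-- Orbital phase asymptotic stability of the `T`-periodic orbit parametrized by `γ`, with respect
to perturbations in `V`. -/
def OrbitallyPhaseAsymptoticallyStable {n : ℕ} (Y : Euc n → Euc n) (V : Set (Euc n))
    (γ : ℝ → Euc n) (T : ℝ) : Prop :=
  OrbitallyAsymptoticallyStable Y V (orbit γ T) ∧
    ∃ δ > 0, ∀ x₀ ∈ V, Metric.infDist x₀ (orbit γ T) < δ →
      SolutionHas Y V x₀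
        (fun x => ∃ θ₀ : ℝ,
          Filter.Tendsto (fun t => dist (x t) (γ (t + θ₀))) Filter.atTop (𝓝 0))

/-- `c` is a regular value of the restriction of `F` to the open set `V`. -/
def IsRegularValueOn {n m : ℕ} (F : Euc n → Euc m) (V : Set (Euc n)) (c : Euc m) : Prop :=
  ∀ u ∈ V, F u = c → Function.Surjective (fderiv ℝ F u)

end PeriodicStab

end

/-!
The vector `N = ⋆(v₁ ∧ ⋯ ∧ vₘ)` of `ℝᵐ⁺¹` represents `w ↦ det (v₁, …, vₘ, w)`; hence it is
orthogonal to every `vⱼ`, and `‖N‖²` is the Gram determinant of the `vⱼ`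
(`inner_normalVec`, `inner_normalVec_self`). Reordering the factors in
`⟪w, Θᵢ⟫ = ⋆(⋀_{j ≠ i} vⱼ ∧ N ∧ w)` gives `⟪vⱼ, Θᵢ⟫ = 0` for `j ≠ i` and
`⟪vᵢ, Θᵢ⟫ = ± ‖N‖²` with exactly the sign in the definition of the perturbation, so that
`⟪∇Iⱼ, 𝕏₀⟫ = hⱼ Iⱼ` (`inner_grads_perturbation`). As `𝕏₀` is also orthogonal to `N`, it lies in the
span of the gradients, and Cramer's rule for their Gram matrix shows that it is smooth. It vanishes
where `I = 0`, so the periodic orbit survives.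

Along every solution of the perturbed system `Iⱼ` is multiplied over one period by the exponential
of the integral of `hⱼ`. By Grönwall, a solution starting near the orbit follows it for one period,
so this factor is close to `exp (∫₀ᵀ hⱼ ∘ γ)` (`exists_eq_mul_exp_period`), and the `Iⱼ` contract,
respectively expand, over each period near the orbit. Since the gradients and `X` are independent
along the orbit, the map `u ↦ (I u, ⟪X p, u⟫)` is expanding near each point `p` of it, which yields
`dist (u, Γ) ≤ C ‖I u‖` near `Γ` (`exists_nhds_infDist_le_mul_norm`). Contraction of `I` is
therefore contraction of the distance to `Γ`: at the times `nT` this distance decays geometrically,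
the points of `Γ` nearest to the solution at these times form a Cauchy sequence, and their limit is
the asymptotic phase (`exists_tendsto_dist_of_geometric`). If some `I_{i₀}` expands instead, a
solution with `I_{i₀} ≠ 0` cannot stay near `Γ` (`exists_eq_zero_of_infDist_lt`).

Solutions are produced by replacing the vector field with a bounded, globally Lipschitz field `F`
that agrees with it near `Γ`; a solution that stays near `Γ` does not see the difference
(`IsForwardSolution.eqOn_of_infDist_lt`).
-/

namespace PeriodicStab

/-! ### The Hodge star and interior products -/

theorem hodgeStar_one (n : ℕ) : hodgeStar n 1 = vol n := by
  simp [hodgeStar]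

theorem hodgeStar_mul_ι (n : ℕ) (x : ExteriorAlgebra ℝ (Euc n)) (w : Euc n) :
    hodgeStar n (x * ExteriorAlgebra.ι ℝ w) = interiorProd n w (hodgeStar n x) := by
  simp [hodgeStar, interiorMul]

theorem interiorProd_ι_mul {n : ℕ} (w a : Euc n) (x : ExteriorAlgebra ℝ (Euc n)) :
    interiorProd n w (ExteriorAlgebra.ι ℝ a * x) =
      ⟪w, a⟫ • x - ExteriorAlgebra.ι ℝ a * interiorProd n w x :=
  CliffordAlgebra.contractLeft_ι_mul (Q := (0 : QuadraticForm ℝ (Euc n))) (innerₗ (Euc n) w) a x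

theorem interiorProd_one {n : ℕ} (w : Euc n) : interiorProd n w 1 = 0 :=
  CliffordAlgebra.contractLeft_one (Q := (0 : QuadraticForm ℝ (Euc n))) (innerₗ (Euc n) w)

theorem interiorProd_ι {n : ℕ} (w a : Euc n) :
    interiorProd n w (ExteriorAlgebra.ι ℝ a) = algebraMap ℝ _ ⟪w, a⟫ := by
  have := interiorProd_ι_mul w a 1
  rwa [mul_one, interiorProd_one, mul_zero, sub_zero, ← Algebra.algebraMap_eq_smul_one] at this

/-- The interior product with a vector lowers the degree by one. -/
theorem interiorProd_mem_exteriorPower {n : ℕ} (w : Euc n) (k : ℕ) :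
    ∀ x ∈ ⋀[ℝ]^(k + 1) (Euc n), interiorProd n w x ∈ ⋀[ℝ]^k (Euc n) := by
  induction k with
  | zero =>
    intro x hx
    rw [ExteriorAlgebra.exteriorPower, zero_add, pow_one] at hx
    obtain ⟨a, rfl⟩ := hx
    rw [interiorProd_ι, ExteriorAlgebra.exteriorPower, pow_zero]
    exact Submodule.algebraMap_mem _
  | succ k ih =>
    intro x hx
    rw [ExteriorAlgebra.exteriorPower, pow_succ'] at hx
    induction hx using Submodule.mul_induction_on' with
    | mem_mul_mem a ha y hy =>
      obtain ⟨a, rfl⟩ := ha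
      rw [interiorProd_ι_mul]
      refine Submodule.sub_mem _ (Submodule.smul_mem _ _ hy) ?_
      rw [ExteriorAlgebra.exteriorPower, pow_succ']
      exact Submodule.mul_mem_mul ⟨a, rfl⟩ (ih y hy)
    | add x _ y _ hx hy => rw [map_add]; exact Submodule.add_mem _ hx hy

theorem hodgeStar_prod_mem_exteriorPower {n : ℕ} (l : List (Euc n)) :
    ∀ k, l.length + k = n → hodgeStar n (l.map (ExteriorAlgebra.ι ℝ)).prod ∈ ⋀[ℝ]^k (Euc n) := by
  induction l using List.reverseRecOn with
  | nil =>
    intro k hk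
    obtain rfl : k = n := by simpa using hk
    simp only [List.map_nil, List.prod_nil, hodgeStar_one]
    exact ExteriorAlgebra.ιMulti_range ℝ k ⟨_, rfl⟩
  | append_singleton l a ih =>
    intro k hk
    simp only [List.map_append, List.prod_append, List.map_singleton, List.prod_singleton,
      hodgeStar_mul_ι]
    refine interiorProd_mem_exteriorPower a k _ (ih (k + 1) ?_)
    simp at hk; omega

/-- In `ℝᵐ⁺¹` the Hodge star of a product of `m` vectors is a vector. -/
theorem exists_hodgeStar_prod_eq_ι {m : ℕ} (l : List (Euc (m + 1))) (hl : l.length = m) :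
    ∃ N : Euc (m + 1),
      hodgeStar (m + 1) (l.map (ExteriorAlgebra.ι ℝ)).prod = ExteriorAlgebra.ι ℝ N := by
  have := hodgeStar_prod_mem_exteriorPower l 1 (by omega)
  rw [ExteriorAlgebra.exteriorPower, pow_one] at this
  obtain ⟨N, hN⟩ := this
  exact ⟨N, hN.symm⟩

theorem interiorProd_prod_eq_zero {n : ℕ} (w : Euc n) (l : List (Euc n))
    (hl : ∀ a ∈ l, ⟪w, a⟫ = 0) :
    interiorProd n w (l.map (ExteriorAlgebra.ι ℝ)).prod = 0 := by
  induction l with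
  | nil => simp [interiorProd_one]
  | cons a l ih =>
    rw [List.map_cons, List.prod_cons, interiorProd_ι_mul, hl a (by simp),
      ih (fun b hb => hl b (by simp [hb]))]
    simp

/-- Contracting `l₁ ∧ ⋯ ∧ lₖ ∧ z`, with `z` the product of `r`, successively with `l₁, …, lₖ` leaves
`z` if the vectors are pairwise orthogonal and the `lᵢ` have norm one. -/
theorem unop_interiorMul_prod_apply {n : ℕ} (l r : List (Euc n))
    (h1 : ∀ a ∈ l, ⟪a, a⟫ = 1) (hp : (l ++ r).Pairwise (fun a b => ⟪a, b⟫ = 0)) :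
    (interiorMul n (l.map (ExteriorAlgebra.ι ℝ)).prod).unop
      ((l ++ r).map (ExteriorAlgebra.ι ℝ)).prod = (r.map (ExteriorAlgebra.ι ℝ)).prod := by
  induction l with
  | nil => simp
  | cons a l ih =>
    rw [List.cons_append, List.pairwise_cons] at hp
    have h : (interiorMul n (ExteriorAlgebra.ι ℝ a)).unop
        (((a :: l) ++ r).map (ExteriorAlgebra.ι ℝ)).prod =
        ((l ++ r).map (ExteriorAlgebra.ι ℝ)).prod := by
      have : (interiorMul n (ExteriorAlgebra.ι ℝ a)).unop = interiorProd n a := by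
        simp [interiorMul]
      rw [this, List.cons_append, List.map_cons, List.prod_cons, interiorProd_ι_mul,
        interiorProd_prod_eq_zero a _ hp.1, h1 a (by simp)]
      simp
    rw [List.map_cons, List.prod_cons, map_mul, MulOpposite.unop_mul, Module.End.mul_apply, h]
    exact ih (fun b hb => h1 b (by simp [hb])) hp.2

theorem hodgeStar_vol (n : ℕ) : hodgeStar n (vol n) = 1 := by
  have hv : vol n = (((List.ofFn fun i => EuclideanSpace.basisFun (Fin n) ℝ i) ++ []).map
      (ExteriorAlgebra.ι ℝ)).prod := by
    rw [vol, ExteriorAlgebra.ιMulti_apply, List.append_nil, List.map_ofFn]; rfl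
  have := unop_interiorMul_prod_apply
    (List.ofFn fun i => EuclideanSpace.basisFun (Fin n) ℝ i) [] ?_ ?_
  · rw [← hv] at this
    rw [List.append_nil] at hv
    rwa [← hv] at this
  · intro a ha
    obtain ⟨i, rfl⟩ := List.mem_ofFn.1 ha
    simp
  · rw [List.append_nil, List.pairwise_ofFn]
    intro i j hij
    exact (EuclideanSpace.basisFun (Fin n) ℝ).inner_eq_zero hij.ne

/-- The Hodge star of an `n`-vector is its coefficient with respect to the volume multivector. -/
theorem hodgeStar_wedge_eq_det {n : ℕ} (u : Fin n → Euc n) :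
    hodgeStar n (wedge u) =
      algebraMap ℝ _ ((EuclideanSpace.basisFun (Fin n) ℝ).toBasis.det u) := by
  have : (hodgeStar n).compAlternatingMap (ExteriorAlgebra.ιMulti ℝ n) =
      (Algebra.linearMap ℝ (ExteriorAlgebra ℝ (Euc n))).compAlternatingMap
        (EuclideanSpace.basisFun (Fin n) ℝ).toBasis.det := by
    refine Module.Basis.ext_alternating (EuclideanSpace.basisFun (Fin n) ℝ).toBasis ?_
    intro v hv
    let σ : Equiv.Perm (Fin n) := Equiv.ofBijective v (Finite.injective_iff_bijective.1 hv)
    change (hodgeStar n) (ExteriorAlgebra.ιMulti ℝ n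
        ((EuclideanSpace.basisFun (Fin n) ℝ).toBasis ∘ σ)) =
      algebraMap ℝ _ ((EuclideanSpace.basisFun (Fin n) ℝ).toBasis.det
        ((EuclideanSpace.basisFun (Fin n) ℝ).toBasis ∘ σ))
    rw [AlternatingMap.map_perm, AlternatingMap.map_perm, Module.Basis.det_self]
    have h : hodgeStar n (ExteriorAlgebra.ιMulti ℝ n
        (EuclideanSpace.basisFun (Fin n) ℝ).toBasis) = 1 := by
      rw [OrthonormalBasis.coe_toBasis]; exact hodgeStar_vol n
    rcases Int.units_eq_one_or (Equiv.Perm.sign σ) with hσ | hσ <;> rw [hσ] <;>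
      simp only [one_smul, Units.neg_smul, map_neg, map_one, h]
  exact congrArg (fun f => f u) this

/-! ### The vectors `Θᵢ` -/

theorem prod_mul_ι {n : ℕ} (l : List (Euc n)) (a : Euc n) :
    (l.map (ExteriorAlgebra.ι ℝ)).prod * ExteriorAlgebra.ι ℝ a =
      (-1 : ℝ) ^ l.length • (ExteriorAlgebra.ι ℝ a * (l.map (ExteriorAlgebra.ι ℝ)).prod) := by
  induction l with
  | nil => simp
  | cons b l ih =>
    have h : ExteriorAlgebra.ι ℝ b * ExteriorAlgebra.ι ℝ a =
        -(ExteriorAlgebra.ι ℝ a * ExteriorAlgebra.ι ℝ b) :=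
      eq_neg_of_add_eq_zero_left (ExteriorAlgebra.ι_add_mul_swap b a)
    rw [List.map_cons, List.prod_cons, mul_assoc, ih, mul_smul_comm, ← mul_assoc, h, neg_mul,
      List.length_cons, pow_succ, mul_neg_one, neg_smul, smul_neg, mul_assoc]

theorem prod_mul_ι_of_mem {n : ℕ} {l : List (Euc n)} {a : Euc n} (ha : a ∈ l) :
    (l.map (ExteriorAlgebra.ι ℝ)).prod * ExteriorAlgebra.ι ℝ a = 0 := by
  induction l with
  | nil => simp at ha
  | cons b l ih =>
    rcases List.mem_cons.1 ha with rfl | h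
    · rw [prod_mul_ι, List.map_cons, List.prod_cons, ← mul_assoc, ExteriorAlgebra.ι_sq_zero,
        zero_mul, smul_zero]
    · rw [List.map_cons, List.prod_cons, mul_assoc, ih h, mul_zero]

theorem wedge_eq_prod {n m : ℕ} (v : Fin m → Euc n) :
    wedge v = (((List.finRange m).map v).map (ExteriorAlgebra.ι ℝ)).prod := by
  rw [wedge, ExteriorAlgebra.ιMulti_apply, List.ofFn_eq_map, List.map_map]; rfl

theorem wedgeOmit_eq_prod {n m : ℕ} (v : Fin m → Euc n) (i : Fin m) :
    wedgeOmit v i = ((((List.finRange m).filter (fun j => j ≠ i)).map v).map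
      (ExteriorAlgebra.ι ℝ)).prod := by
  rw [wedgeOmit, List.map_map]; rfl

theorem length_filter_finRange_ne {m : ℕ} (i : Fin m) :
    ((List.finRange m).filter (fun j => j ≠ i)).length + 1 = m := by
  have h := List.length_eq_length_filter_add (l := List.finRange m) (fun j => decide (j ≠ i))
  have h1 : ((List.finRange m).filter (fun j => !decide (j ≠ i))).length = 1 := by
    have : (fun j => !decide (j ≠ i)) = fun j => decide (j = i) := by ext j; simp
    rw [this, ← List.countP_eq_length_filter]
    have := List.count_eq_one_of_mem (List.nodup_finRange m) (List.mem_finRange i)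
    rw [← this, List.count]; congr 1
  rw [h1, List.length_finRange] at h
  exact h.symm

theorem wedgeOmit_mul_ι_of_ne {n m : ℕ} (v : Fin m → Euc n) {i j : Fin m} (h : j ≠ i) :
    wedgeOmit v i * ExteriorAlgebra.ι ℝ (v j) = 0 := by
  rw [wedgeOmit_eq_prod]
  exact prod_mul_ι_of_mem (List.mem_map_of_mem (by simp [h]))

theorem wedgeOmit_mul_ι_self {n m : ℕ} (v : Fin m → Euc n) (i : Fin m) :
    wedgeOmit v i * ExteriorAlgebra.ι ℝ (v i) = (-1 : ℝ) ^ (m - (i + 1)) • wedge v := by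
  have hs : List.finRange m = (List.finRange m).take i ++ i :: (List.finRange m).drop (i + 1) := by
    have := List.take_append_drop (i : ℕ) (List.finRange m)
    rw [List.drop_eq_getElem_cons (by simp)] at this
    simpa using this.symm
  have hnd := List.nodup_finRange m
  rw [hs] at hnd
  have hf : (List.finRange m).filter (fun j => j ≠ i) =
      (List.finRange m).take i ++ (List.finRange m).drop (i + 1) := by
    conv_lhs => rw [hs]
    rw [List.nodup_append] at hnd
    rw [List.filter_append, List.filter_cons_of_neg (by simp), List.filter_eq_self.2,
      List.filter_eq_self.2]
    · intro a ha
      have := (List.nodup_cons.1 hnd.2.1).1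
      simpa using fun h : a = i => this (h ▸ ha)
    · intro a ha
      simpa using hnd.2.2 a ha i (by simp)
  have hl : ((List.finRange m).drop (i + 1)).length = m - (i + 1) := by simp
  rw [wedgeOmit_eq_prod, wedge_eq_prod, hf]
  conv_rhs => rw [hs]
  simp only [List.map_append, List.prod_append, List.map_cons, List.prod_cons]
  rw [mul_assoc, prod_mul_ι, List.length_map, hl, mul_smul_comm]

theorem wedge_snoc {n m : ℕ} (v : Fin m → Euc n) (w : Euc n) :
    wedge (Fin.snoc v w : Fin (m + 1) → Euc n) = wedge v * ExteriorAlgebra.ι ℝ w := by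
  simp only [wedge, ExteriorAlgebra.ιMulti_apply, List.ofFn_succ', List.concat_eq_append,
    List.prod_append, Fin.snoc_castSucc, Fin.snoc_last, List.prod_singleton]

/-- The vector `⋆(v₁ ∧ ⋯ ∧ v_{n-1})` of `ℝⁿ`, the generalized cross product. It is read off with
`ιInv`, which loses nothing since the multivector has degree one (`hodgeStar_wedge`). -/
noncomputable def normalVec {m : ℕ} (v : Fin m → Euc (m + 1)) : Euc (m + 1) :=
  ExteriorAlgebra.ιInv (hodgeStar (m + 1) (wedge v))

theorem hodgeStar_wedge {m : ℕ} (v : Fin m → Euc (m + 1)) :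
    hodgeStar (m + 1) (wedge v) = ExteriorAlgebra.ι ℝ (normalVec v) := by
  obtain ⟨N, hN⟩ := exists_hodgeStar_prod_eq_ι ((List.finRange m).map v) (by simp)
  rw [← wedge_eq_prod] at hN
  rw [normalVec, hN, ExteriorAlgebra.ι_leftInverse]

theorem algebraMap_inner_normalVec {m : ℕ} (v : Fin m → Euc (m + 1)) (w : Euc (m + 1)) :
    algebraMap ℝ (ExteriorAlgebra ℝ (Euc (m + 1))) ⟪w, normalVec v⟫ =
      hodgeStar (m + 1) (wedge v * ExteriorAlgebra.ι ℝ w) := by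
  rw [hodgeStar_mul_ι, hodgeStar_wedge, interiorProd_ι]

/-- The determinant is `wedge v ∧ w` starred, that is, `wedge v` starred and contracted with `w`. -/
theorem inner_normalVec {m : ℕ} (v : Fin m → Euc (m + 1)) (w : Euc (m + 1)) :
    ⟪w, normalVec v⟫ = (EuclideanSpace.basisFun (Fin (m + 1)) ℝ).toBasis.det
      (Fin.snoc v w : Fin (m + 1) → Euc (m + 1)) := by
  apply (ExteriorAlgebra.algebraMap_inj (M := Euc (m + 1)) _ _).1
  rw [algebraMap_inner_normalVec, ← wedge_snoc, hodgeStar_wedge_eq_det]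

theorem inner_self_normalVec {m : ℕ} (v : Fin m → Euc (m + 1)) (j : Fin m) :
    ⟪v j, normalVec v⟫ = 0 := by
  rw [inner_normalVec]
  refine AlternatingMap.map_eq_zero_of_eq _ _ (i := j.castSucc) (j := Fin.last m) ?_ ?_
  · simp
  · exact (Fin.castSucc_lt_last j).ne

theorem det_sq_eq_det_gram {n : ℕ} (u : Fin n → Euc n) :
    (EuclideanSpace.basisFun (Fin n) ℝ).toBasis.det u ^ 2 = (Matrix.gram ℝ u).det := by
  set A := (EuclideanSpace.basisFun (Fin n) ℝ).toBasis.toMatrix u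
  have : Matrix.gram ℝ u = A.transpose * A := by
    ext i j
    simp only [Matrix.gram_apply, Matrix.mul_apply, Matrix.transpose_apply, A,
      Module.Basis.toMatrix_apply, OrthonormalBasis.coe_toBasis_repr_apply,
      EuclideanSpace.basisFun_repr]
    rw [PiLp.inner_apply]
    simp [mul_comm]
  rw [this, Matrix.det_mul, Matrix.det_transpose, Module.Basis.det_apply, sq]

theorem det_gram_snoc {n m : ℕ} (v : Fin m → Euc n) (w : Euc n) (h : ∀ j, ⟪v j, w⟫ = 0) :
    (Matrix.gram ℝ (Fin.snoc v w : Fin (m + 1) → Euc n)).det =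
      (Matrix.gram ℝ v).det * ⟪w, w⟫ := by
  rw [Matrix.det_succ_row _ (Fin.last m), Fin.sum_univ_castSucc, Finset.sum_eq_zero]
  · have : (Matrix.gram ℝ (Fin.snoc v w : Fin (m + 1) → Euc n)).submatrix
        (Fin.last m).succAbove (Fin.last m).succAbove = Matrix.gram ℝ v := by
      ext i j; simp
    rw [this]
    simp only [Matrix.gram_apply, Fin.snoc_last, Fin.val_last, ← two_mul, pow_mul]
    norm_num; ring
  · intro j _
    have hj : ⟪w, v j⟫ = 0 := by rw [real_inner_comm]; exact h j
    simp [hj]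

theorem normalVec_ne_zero {m : ℕ} {v : Fin m → Euc (m + 1)} (hv : LinearIndependent ℝ v) :
    normalVec v ≠ 0 := by
  intro h0
  obtain ⟨w, hw⟩ : ∃ w, w ∉ Submodule.span ℝ (Set.range v) := by
    by_contra! hall
    have h1 : Submodule.span ℝ (Set.range v) = ⊤ := by ext w; simp [hall w]
    have h2 := finrank_span_eq_card hv
    rw [h1, finrank_top] at h2
    simp at h2
  have hli : LinearIndependent ℝ (Fin.snoc v w : Fin (m + 1) → Euc (m + 1)) :=
    linearIndependent_finSnoc.2 ⟨hv, hw⟩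
  have := inner_normalVec v w
  rw [h0, inner_zero_right] at this
  have hu := ((EuclideanSpace.basisFun (Fin (m + 1)) ℝ).toBasis.is_basis_iff_det
    (v := (Fin.snoc v w : Fin (m + 1) → Euc (m + 1)))).1
    ⟨hli, hli.span_eq_top_of_card_eq_finrank' (by simp)⟩
  rw [← this] at hu
  simp at hu

/-- Both sides agree after multiplication by `‖N‖²`, `N = normalVec v`: then each is
`det (v₁, …, vₘ, N)²`, the Gram matrix of `v₁, …, vₘ, N` being block diagonal. -/
theorem inner_normalVec_self {m : ℕ} {v : Fin m → Euc (m + 1)} (hv : LinearIndependent ℝ v) :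
    ⟪normalVec v, normalVec v⟫ = (Matrix.gram ℝ v).det := by
  have h1 := det_sq_eq_det_gram (Fin.snoc v (normalVec v) : Fin (m + 1) → Euc (m + 1))
  rw [det_gram_snoc v _ (inner_self_normalVec v), ← inner_normalVec, sq] at h1
  exact mul_right_cancel₀ (inner_self_ne_zero.2 (normalVec_ne_zero hv)) h1

theorem algebraMap_inner_Theta {m : ℕ} (v : Fin m → Euc (m + 1)) (i : Fin m) (w : Euc (m + 1)) :
    algebraMap ℝ (ExteriorAlgebra ℝ (Euc (m + 1))) ⟪w, Theta v i⟫ =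
      hodgeStar (m + 1)
        (wedgeOmit v i * ExteriorAlgebra.ι ℝ (normalVec v) * ExteriorAlgebra.ι ℝ w) := by
  obtain ⟨N, hN⟩ := exists_hodgeStar_prod_eq_ι
    (((List.finRange m).filter (fun j => j ≠ i)).map v ++ [normalVec v])
    (by simpa using length_filter_finRange_ne i)
  rw [List.map_append, List.prod_append, ← wedgeOmit_eq_prod, List.map_singleton,
    List.prod_singleton] at hN
  rw [hodgeStar_mul_ι, Theta, hodgeStar_wedge, hN, ExteriorAlgebra.ι_leftInverse, interiorProd_ι]

theorem inner_normalVec_Theta {m : ℕ} (v : Fin m → Euc (m + 1)) (i : Fin m) :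
    ⟪normalVec v, Theta v i⟫ = 0 := by
  apply (ExteriorAlgebra.algebraMap_inj (M := Euc (m + 1)) _ _).1
  rw [algebraMap_inner_Theta, mul_assoc, ExteriorAlgebra.ι_sq_zero, mul_zero, map_zero, map_zero]

theorem mul_ι_mul_ι_swap {n : ℕ} (x : ExteriorAlgebra ℝ (Euc n)) (a b : Euc n) :
    x * ExteriorAlgebra.ι ℝ a * ExteriorAlgebra.ι ℝ b =
      -(x * ExteriorAlgebra.ι ℝ b * ExteriorAlgebra.ι ℝ a) := by
  have h := eq_neg_of_add_eq_zero_left (ExteriorAlgebra.ι_add_mul_swap (R := ℝ) a b)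
  rw [mul_assoc, h, mul_neg, mul_assoc]

theorem inner_Theta_of_ne {m : ℕ} (v : Fin m → Euc (m + 1)) {i j : Fin m} (h : j ≠ i) :
    ⟪v j, Theta v i⟫ = 0 := by
  apply (ExteriorAlgebra.algebraMap_inj (M := Euc (m + 1)) _ _).1
  rw [algebraMap_inner_Theta, mul_ι_mul_ι_swap, wedgeOmit_mul_ι_of_ne v h]
  simp

theorem inner_Theta_self {m : ℕ} (v : Fin m → Euc (m + 1)) (i : Fin m) :
    ⟪v i, Theta v i⟫ = (-1 : ℝ) ^ (m + 1 - (i + 1)) * ⟪normalVec v, normalVec v⟫ := by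
  apply (ExteriorAlgebra.algebraMap_inj (M := Euc (m + 1)) _ _).1
  have hm : m + 1 - (i + 1) = (m - (i + 1)) + 1 := by omega
  rw [algebraMap_inner_Theta, mul_ι_mul_ι_swap, wedgeOmit_mul_ι_self, map_mul,
    algebraMap_inner_normalVec, hm, pow_succ, mul_neg_one, map_neg, map_neg, smul_mul_assoc,
    map_smul, Algebra.smul_def, neg_mul]

/-! ### The perturbation -/

theorem norm_ιMulti_sq {n m : ℕ} (v : Fin m → Euc n) :
    ‖exteriorPower.ιMulti ℝ m v‖ ^ 2 = (Matrix.gram ℝ v).det := by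
  rw [← real_inner_self_eq_norm_sq, exteriorPower.inner_ιMulti_self]

/-- The defining property of the perturbation: `ℒ_{𝕏₀} Iⱼ = hⱼ Iⱼ`. -/
theorem inner_grads_perturbation {m : ℕ} (I : Euc (m + 1) → Euc m)
    (h : Fin m → Euc (m + 1) → ℝ) (u : Euc (m + 1)) (hu : LinearIndependent ℝ (grads I u))
    (j : Fin m) : ⟪grads I u j, perturbation I h u⟫ = h j u * I u j := by
  rw [perturbation, inner_smul_right, inner_sum, Finset.sum_eq_single j, inner_smul_right,
    inner_Theta_self, norm_ιMulti_sq, ← inner_normalVec_self hu]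
  · have h1 := inner_self_ne_zero (𝕜 := ℝ).2 (normalVec_ne_zero hu)
    have h2 : (-1 : ℝ) ^ (m + 1 - (j + 1)) * (-1 : ℝ) ^ (m + 1 - (j + 1)) = 1 := by
      rw [← mul_pow]; simp
    field_simp
    linear_combination (h j u * I u j) * h2
  · intro i _ hi
    rw [inner_smul_right, inner_Theta_of_ne _ hi.symm, mul_zero]
  · simp

theorem inner_normalVec_perturbation {m : ℕ} (I : Euc (m + 1) → Euc m)
    (h : Fin m → Euc (m + 1) → ℝ) (u : Euc (m + 1)) :
    ⟪normalVec (grads I u), perturbation I h u⟫ = 0 := by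
  simp [perturbation, inner_smul_right, inner_sum, inner_normalVec_Theta]

theorem perturbation_eq_zero {m : ℕ} {I : Euc (m + 1) → Euc m}
    (h : Fin m → Euc (m + 1) → ℝ) {u : Euc (m + 1)} (hu : I u = 0) :
    perturbation I h u = 0 := by
  simp [perturbation, hu]

theorem eq_zero_of_inner_normalVec {m : ℕ} {v : Fin m → Euc (m + 1)}
    (hv : LinearIndependent ℝ v) {w : Euc (m + 1)} (h : ∀ j, ⟪v j, w⟫ = 0)
    (hN : ⟪normalVec v, w⟫ = 0) : w = 0 := by
  by_contra hw
  have hli : LinearIndependent ℝ (Fin.snoc v w : Fin (m + 1) → Euc (m + 1)) := by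
    refine linearIndependent_finSnoc.2 ⟨hv, fun hmem => hw ?_⟩
    have hle : Submodule.span ℝ (Set.range v) ≤ LinearMap.ker (innerₗ (Euc (m + 1)) w) := by
      rw [Submodule.span_le]
      rintro _ ⟨j, rfl⟩
      have hj : ⟪w, v j⟫ = 0 := by rw [real_inner_comm]; exact h j
      simp [hj]
    simpa using hle hmem
  have hu := ((EuclideanSpace.basisFun (Fin (m + 1)) ℝ).toBasis.is_basis_iff_det
    (v := (Fin.snoc v w : Fin (m + 1) → Euc (m + 1)))).1
    ⟨hli, hli.span_eq_top_of_card_eq_finrank' (by simp)⟩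
  rw [← inner_normalVec, real_inner_comm, hN] at hu
  simp at hu

/-- The perturbation is the combination of the gradients whose coefficients solve, by Cramer's
rule, the linear system with the Gram matrix of the gradients. -/
theorem perturbation_eq_cramer {m : ℕ} (I : Euc (m + 1) → Euc m)
    (h : Fin m → Euc (m + 1) → ℝ) (u : Euc (m + 1)) (hu : LinearIndependent ℝ (grads I u)) :
    perturbation I h u = (Matrix.gram ℝ (grads I u)).det⁻¹ •
      ∑ i, (Matrix.gram ℝ (grads I u)).cramer (fun j => h j u * I u j) i • grads I u i := by
  have hdet : (Matrix.gram ℝ (grads I u)).det ≠ 0 := by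
    rw [← inner_normalVec_self hu]
    exact inner_self_ne_zero.2 (normalVec_ne_zero hu)
  rw [← sub_eq_zero]
  refine eq_zero_of_inner_normalVec hu (fun j => ?_) ?_
  · have := congrFun (Matrix.mulVec_cramer (Matrix.gram ℝ (grads I u))
      (fun j => h j u * I u j)) j
    simp only [Matrix.mulVec, dotProduct, Matrix.gram_apply, Pi.smul_apply, smul_eq_mul] at this
    rw [inner_sub_right, inner_grads_perturbation I h u hu, inner_smul_right, inner_sum]
    simp only [inner_smul_right]
    simp only [mul_comm (⟪grads I u j, _⟫)] at this
    rw [this, inv_mul_cancel_left₀ hdet, sub_self]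
  · rw [inner_sub_right, inner_normalVec_perturbation, inner_smul_right, inner_sum]
    simp [inner_smul_right, real_inner_comm, inner_self_normalVec]

theorem _root_.ContDiffOn.matrix_det {E : Type*} [NormedAddCommGroup E] [NormedSpace ℝ E]
    {k : ℕ} {r : WithTop ℕ∞} {s : Set E} {A : E → Matrix (Fin k) (Fin k) ℝ}
    (hA : ∀ i j, ContDiffOn ℝ r (fun x => A x i j) s) :
    ContDiffOn ℝ r (fun x => (A x).det) s := by
  simp only [Matrix.det_apply]
  refine ContDiffOn.sum fun σ _ => ContDiffOn.const_smul _ ?_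
  exact contDiffOn_prod fun i _ => hA _ _

theorem contDiffOn_grads {n m : ℕ} {I : Euc n → Euc m} {V : Set (Euc n)} (hV : IsOpen V)
    (hI : ContDiffOn ℝ ∞ I V) (j : Fin m) : ContDiffOn ℝ ∞ (fun u => grads I u j) V := by
  have h1 : ContDiffOn ℝ ∞ (fun x => I x j) V := (contDiffOn_piLp 2).1 hI j
  have h2 := h1.fderiv_of_isOpen (m := ∞) hV (by simp)
  exact ((InnerProductSpace.toDual ℝ (Euc n)).symm.contDiff).comp_contDiffOn h2

theorem contDiffOn_perturbation {m : ℕ} {I : Euc (m + 1) → Euc m} {V : Set (Euc (m + 1))}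
    (hV : IsOpen V) (hI : ContDiffOn ℝ ∞ I V) (hrank : ∀ u ∈ V, LinearIndependent ℝ (grads I u))
    {h : Fin m → Euc (m + 1) → ℝ} (hh : ∀ i, ContDiffOn ℝ ∞ (h i) V) :
    ContDiffOn ℝ ∞ (perturbation I h) V := by
  refine ContDiffOn.congr ?_ (fun u hu => perturbation_eq_cramer I h u (hrank u hu))
  have hG : ∀ i j, ContDiffOn ℝ ∞ (fun u => Matrix.gram ℝ (grads I u) i j) V := fun i j =>
    (contDiffOn_grads hV hI i).inner ℝ (contDiffOn_grads hV hI j)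
  refine ContDiffOn.smul (ContDiffOn.inv (ContDiffOn.matrix_det hG) fun u hu => ?_) ?_
  · rw [← inner_normalVec_self (hrank u hu)]
    exact inner_self_ne_zero.2 (normalVec_ne_zero (hrank u hu))
  · refine ContDiffOn.sum fun i _ => ContDiffOn.fun_smul ?_ (contDiffOn_grads hV hI i)
    simp only [Matrix.cramer_apply]
    refine ContDiffOn.matrix_det fun k l => ?_
    simp only [Matrix.updateCol_apply]
    split_ifs
    · exact (hh k).mul ((contDiffOn_piLp 2).1 hI k)
    · exact hG k l

/-! ### Globally Lipschitz vector fields -/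

section Lipschitz

open Set Metric Filter

theorem isCompact_range_of_periodic {α : Type*} [TopologicalSpace α] {γ : ℝ → α} {T : ℝ}
    (hγ : Continuous γ) (hT : 0 < T) (hp : Function.Periodic γ T) : IsCompact (range γ) := by
  rw [← hp.image_Icc hT 0]
  exact isCompact_Icc.image hγ

variable {E : Type*} [NormedAddCommGroup E] [NormedSpace ℝ E] {F : E → E} {K : NNReal}

theorem dist_le_mul_exp_of_isIntegralCurve (hF : LipschitzWith K F) {x y : ℝ → E}
    (hx : IsIntegralCurve x fun _ => F) (hy : IsIntegralCurve y fun _ => F) {a t : ℝ}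
    (hat : a ≤ t) : dist (x t) (y t) ≤ dist (x a) (y a) * Real.exp (K * (t - a)) :=
  dist_le_of_trajectories_ODE (v := fun _ => F) (fun _ => hF) hx.continuous.continuousOn
    (fun s _ => (hx s).hasDerivWithinAt) hy.continuous.continuousOn
    (fun s _ => (hy s).hasDerivWithinAt) le_rfl t ⟨hat, le_rfl⟩

theorem eqOn_Icc_of_hasDerivWithinAt (hF : LipschitzWith K F) {x y : ℝ → E} {b : ℝ}
    (hxc : ContinuousOn x (Icc 0 b))
    (hx : ∀ t ∈ Ico 0 b, HasDerivWithinAt x (F (x t)) (Ici t) t)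
    (hy : IsIntegralCurve y fun _ => F) (h0 : x 0 = y 0) : EqOn x y (Icc 0 b) :=
  ODE_solution_unique (v := fun _ => F) (fun _ => hF) hxc hx hy.continuous.continuousOn
    (fun s _ => (hy s).hasDerivWithinAt) h0

/-- A bounded, globally Lipschitz vector field is complete. -/
theorem exists_isIntegralCurve_of_lipschitzWith [CompleteSpace E] (hF : LipschitzWith K F)
    {L : NNReal} (hb : ∀ x, ‖F x‖ ≤ L) (x₀ : E) :
    ∃ x : ℝ → E, x 0 = x₀ ∧ IsIntegralCurve x fun _ => F := by
  have hloc : ∀ n : ℕ, ∃ α : ℝ → E, α 0 = x₀ ∧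
      ∀ t ∈ Ioo (-(n + 1 : ℝ)) (n + 1), HasDerivAt α (F (α t)) t := by
    intro n
    have hpos : (0 : ℝ) < n + 1 := by positivity
    -- the bound on `F` is global, so the radius of the ball may be taken as large as needed
    have hp : IsPicardLindelof (fun _ => F) (tmin := -(n + 1 : ℝ)) (tmax := n + 1)
        ⟨0, by constructor <;> linarith⟩ x₀ (L * (n + 1)) 0 L K :=
      IsPicardLindelof.of_time_independent (fun x _ => hb x) hF.lipschitzOnWith (by simp)
    obtain ⟨α, h0, hα⟩ := hp.exists_eq_forall_mem_Icc_hasDerivWithinAt₀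
    exact ⟨α, h0, fun t ht => (hα t (Ioo_subset_Icc_self ht)).hasDerivAt (Icc_mem_nhds ht.1 ht.2)⟩
  choose α h0 hα using hloc
  have hagree : ∀ n k : ℕ, n ≤ k → EqOn (α n) (α k) (Ioo (-(n + 1 : ℝ)) (n + 1)) := by
    intro n k hnk
    have hnk' : (n : ℝ) ≤ k := by exact_mod_cast hnk
    have hpos : (0 : ℝ) ≤ n := by positivity
    refine ODE_solution_unique_of_mem_Ioo (v := fun _ => F) (s := fun _ => univ) (t₀ := 0)
      (fun _ _ => hF.lipschitzOnWith) ⟨by linarith, by linarith⟩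
      (fun t ht => ⟨hα n t ht, trivial⟩)
      (fun t ht => ⟨hα k t ⟨by linarith [ht.1], by linarith [ht.2]⟩, trivial⟩) ?_
    rw [h0, h0]
  -- glue the solutions on growing intervals, which agree on overlaps
  let x : ℝ → E := fun t => α ⌊|t|⌋₊ t
  have hx : ∀ n : ℕ, EqOn x (α n) (Ioo (-(n + 1 : ℝ)) (n + 1)) := by
    intro n t ht
    have h1 : |t| < ((n + 1 : ℕ) : ℝ) := by push_cast; exact abs_lt.2 ht
    refine hagree _ _ (Nat.lt_succ_iff.1 ((Nat.floor_lt (abs_nonneg t)).2 h1)) ?_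
    exact abs_lt.1 (Nat.lt_floor_add_one |t|)
  refine ⟨x, by simp [x, h0], fun t => ?_⟩
  have ht : t ∈ Ioo (-(⌊|t|⌋₊ + 1 : ℝ)) (⌊|t|⌋₊ + 1) := abs_lt.1 (Nat.lt_floor_add_one |t|)
  have := hα _ t ht
  exact this.congr_of_eventuallyEq
    (eventually_of_mem (isOpen_Ioo.mem_nhds ht) fun s hs => hx _ hs)

variable {γ : ℝ → E} {T : ℝ}

/-- A solution is shadowed by the solution on the orbit `range γ` issued from the point nearest to
its initial value. -/
theorem exists_dist_le_infDist_mul_exp (hF : LipschitzWith K F)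
    (hγ : IsIntegralCurve γ fun _ => F) (hT : 0 < T) (hp : Function.Periodic γ T)
    {x : ℝ → E} (hx : IsIntegralCurve x fun _ => F) (a : ℝ) :
    ∃ s, ∀ t, a ≤ t →
      dist (x t) (γ (t - a + s)) ≤ infDist (x a) (range γ) * Real.exp (K * (t - a)) := by
  obtain ⟨_, ⟨s, rfl⟩, hs⟩ := (isCompact_range_of_periodic hγ.continuous hT hp).exists_infDist_eq_dist
    (range_nonempty γ) (x a)
  refine ⟨s, fun t hat => ?_⟩
  have hy : IsIntegralCurve (fun t => γ (t - a + s)) fun _ => F := fun t => by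
    have h := hγ (t - a + s)
    simpa [Function.comp_def] using h.scomp t (((hasDerivAt_id t).sub_const a).add_const s)
  have := dist_le_mul_exp_of_isIntegralCurve hF hx hy hat
  simpa [hs] using this

theorem infDist_le_infDist_mul_exp (hF : LipschitzWith K F)
    (hγ : IsIntegralCurve γ fun _ => F) (hT : 0 < T) (hp : Function.Periodic γ T)
    {x : ℝ → E} (hx : IsIntegralCurve x fun _ => F) {a t : ℝ} (hat : a ≤ t) :
    infDist (x t) (range γ) ≤ infDist (x a) (range γ) * Real.exp (K * (t - a)) := by
  obtain ⟨s, hs⟩ := exists_dist_le_infDist_mul_exp hF hγ hT hp hx a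
  exact (infDist_le_dist_of_mem (mem_range_self _)).trans (hs t hat)

/-- Over one period, the integral of a continuous function along a solution that starts near the
periodic orbit is close to the integral along the orbit. -/
theorem exists_abs_integral_sub_le (hF : LipschitzWith K F)
    (hγ : IsIntegralCurve γ fun _ => F) (hT : 0 < T) (hp : Function.Periodic γ T)
    {N : Set E} (hN : IsOpen N) (hγN : range γ ⊆ N) {g : E → ℝ} (hg : ContinuousOn g N)
    {η : ℝ} (hη : 0 < η) :
    ∃ ρ > 0, ∀ x : ℝ → E, IsIntegralCurve x (fun _ => F) → ∀ a, infDist (x a) (range γ) < ρ →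
      (∀ t ∈ Icc a (a + T), x t ∈ N) ∧
      |(∫ t in a..a + T, g (x t)) - ∫ t in (0 : ℝ)..T, g (γ t)| ≤ η := by
  have hcomp := isCompact_range_of_periodic hγ.continuous hT hp
  obtain ⟨r₁, hr₁, hr₁N⟩ := hcomp.exists_thickening_subset_open hN hγN
  have huc := hcomp.uniformContinuousAt_of_continuousAt g
    (fun p hpm => hg.continuousAt (hN.mem_nhds (hγN hpm)))
    (dist_mem_uniformity (div_pos hη hT))
  obtain ⟨r₂, hr₂, hr₂g⟩ := mem_uniformity_dist.1 huc
  set M := Real.exp (K * T)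
  have hM : 0 < M := Real.exp_pos _
  -- by Grönwall, the distance grows at most by the factor `M` over one period
  refine ⟨min r₁ r₂ / M, div_pos (lt_min hr₁ hr₂) hM, fun x hx a hxa => ?_⟩
  obtain ⟨s, hs⟩ := exists_dist_le_infDist_mul_exp hF hγ hT hp hx a
  have hclose : ∀ t ∈ Icc a (a + T), dist (x t) (γ (t - a + s)) < min r₁ r₂ := by
    intro t ht
    calc dist (x t) (γ (t - a + s)) ≤ infDist (x a) (range γ) * Real.exp (K * (t - a)) :=
          hs t ht.1
      _ ≤ infDist (x a) (range γ) * M := by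
          have h1 : t - a ≤ T := by linarith [ht.2]
          have := infDist_nonneg (x := x a) (s := range γ)
          simp only [M]
          gcongr
      _ < min r₁ r₂ := (lt_div_iff₀ hM).1 hxa
  have hmem : ∀ t ∈ Icc a (a + T), x t ∈ N := fun t ht =>
    hr₁N (mem_thickening_iff.2 ⟨_, mem_range_self _, (hclose t ht).trans_le (min_le_left _ _)⟩)
  refine ⟨hmem, ?_⟩
  have haT : a ≤ a + T := by linarith
  have hγc : Continuous fun t => g (γ t) :=
    hg.comp_continuous hγ.continuous fun t => hγN (mem_range_self t)
  have hperiod : ∫ t in (0 : ℝ)..T, g (γ t) = ∫ t in a..a + T, g (γ (t - a + s)) := by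
    have h1 := intervalIntegral.integral_comp_add_right (a := a) (b := a + T)
      (fun t => g (γ t)) (s - a)
    have h2 := (hp.comp g).intervalIntegral_add_eq 0 (a + (s - a))
    simp only [zero_add, Function.comp_def] at h2
    rw [h2]
    have e1 : ∀ t, t - a + s = t + (s - a) := fun t => by ring
    simp only [e1]
    rw [h1]
    congr 1; ring
  have hi1 : IntervalIntegrable (fun t => g (x t)) MeasureTheory.volume a (a + T) := by
    refine ContinuousOn.intervalIntegrable ?_
    rw [uIcc_of_le haT]
    exact hg.comp hx.continuous.continuousOn hmem
  have hi2 : IntervalIntegrable (fun t => g (γ (t - a + s))) MeasureTheory.volume a (a + T) :=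
    (hγc.comp (by fun_prop : Continuous fun t : ℝ => t - a + s)).intervalIntegrable _ _
  rw [hperiod, ← intervalIntegral.integral_sub hi1 hi2]
  have := intervalIntegral.norm_integral_le_of_norm_le_const (a := a) (b := a + T) (C := η / T)
    (f := fun t => g (x t) - g (γ (t - a + s))) ?_
  · rw [Real.norm_eq_abs] at this
    refine this.trans ?_
    rw [add_sub_cancel_left, abs_of_pos hT, div_mul_cancel₀ _ hT.ne']
  · intro t ht
    rw [uIoc_of_le haT] at ht
    have h1 := hr₂g (a := γ (t - a + s)) (b := x t) (by
      rw [dist_comm]; exact (hclose t (Ioc_subset_Icc_self ht)).trans_le (min_le_right _ _))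
      (mem_range_self _)
    rw [← dist_eq_norm, dist_comm]
    exact le_of_lt h1

/-- A function `J` with `ℒ_F J = g J` evolves along solutions by the exponential of the integral
of `g`. -/
theorem eq_mul_exp_integral {N : Set E} (hN : IsOpen N) {J g : E → ℝ}
    (hJ : DifferentiableOn ℝ J N) (hg : ContinuousOn g N)
    (hJg : ∀ u ∈ N, fderiv ℝ J u (F u) = g u * J u)
    {x : ℝ → E} (hx : IsIntegralCurve x fun _ => F) {a b : ℝ} (hab : a ≤ b)
    (hmem : ∀ t ∈ Icc a b, x t ∈ N) :
    J (x b) = J (x a) * Real.exp (∫ t in a..b, g (x t)) := by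
  have hO : IsOpen (x ⁻¹' N) := hN.preimage hx.continuous
  have hc : ContinuousOn (fun t => g (x t)) (x ⁻¹' N) :=
    hg.comp hx.continuous.continuousOn fun t ht => ht
  have hA : ∀ t ∈ Icc a b, HasDerivAt (fun t => ∫ s in a..t, g (x s)) (g (x t)) t := by
    intro t ht
    refine intervalIntegral.integral_hasDerivAt_right ?_ ?_ ?_
    · refine (hc.mono fun s hs => ?_).intervalIntegrable
      rw [uIcc_of_le ht.1] at hs
      exact hmem s ⟨hs.1, hs.2.trans ht.2⟩
    · exact hc.stronglyMeasurableAtFilter hO t (hmem t ht)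
    · exact hc.continuousAt (hO.mem_nhds (hmem t ht))
  have hu : ∀ t ∈ Icc a b, HasDerivAt
      (fun t => J (x t) * Real.exp (-∫ s in a..t, g (x s))) 0 t := by
    intro t ht
    have h1 : HasDerivAt (fun t => J (x t)) (g (x t) * J (x t)) t := by
      rw [← hJg _ (hmem t ht)]
      exact ((hJ.differentiableAt (hN.mem_nhds (hmem t ht))).hasFDerivAt).comp_hasDerivAt t (hx t)
    have h2 := h1.mul ((hA t ht).neg.exp)
    refine h2.congr_deriv ?_
    ring
  have := constant_of_has_deriv_right_zero
    (fun t ht => (hu t ht).continuousAt.continuousWithinAt)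
    (fun t ht => (hu t (Ico_subset_Icc_self ht)).hasDerivWithinAt) b ⟨hab, le_rfl⟩
  simp only [intervalIntegral.integral_same, neg_zero, Real.exp_zero, mul_one] at this
  rw [← this, mul_assoc, ← Real.exp_add]
  simp

/-- The multiplier of `J` over one period is close to `exp (∫₀ᵀ g ∘ γ)`. -/
theorem exists_eq_mul_exp_period (hF : LipschitzWith K F)
    (hγ : IsIntegralCurve γ fun _ => F) (hT : 0 < T) (hp : Function.Periodic γ T)
    {N : Set E} (hN : IsOpen N) (hγN : range γ ⊆ N) {J g : E → ℝ}
    (hJ : DifferentiableOn ℝ J N) (hg : ContinuousOn g N)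
    (hJg : ∀ u ∈ N, fderiv ℝ J u (F u) = g u * J u) {η : ℝ} (hη : 0 < η) :
    ∃ ρ > 0, ∀ x : ℝ → E, IsIntegralCurve x (fun _ => F) → ∀ a, infDist (x a) (range γ) < ρ →
      ∃ r, |r - ∫ t in (0 : ℝ)..T, g (γ t)| ≤ η ∧ J (x (a + T)) = J (x a) * Real.exp r := by
  obtain ⟨ρ, hρ, h⟩ := exists_abs_integral_sub_le hF hγ hT hp hN hγN hg hη
  exact ⟨ρ, hρ, fun x hx a ha => ⟨_, (h x hx a ha).2,
    eq_mul_exp_integral hN hJ hg hJg hx (by linarith) (h x hx a ha).1⟩⟩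

/-- If every `∫₀ᵀ gⱼ ∘ γ` is negative, then over one period all the `Jⱼ` contract uniformly near the
orbit. -/
theorem exists_norm_le_mul_norm_period {m : ℕ} (hF : LipschitzWith K F)
    (hγ : IsIntegralCurve γ fun _ => F) (hT : 0 < T) (hp : Function.Periodic γ T)
    {N : Set E} (hN : IsOpen N) (hγN : range γ ⊆ N) {J : E → Fin m → ℝ} {g : Fin m → E → ℝ}
    (hJ : ∀ j, DifferentiableOn ℝ (fun u => J u j) N) (hg : ∀ j, ContinuousOn (g j) N)
    (hJg : ∀ j, ∀ u ∈ N, fderiv ℝ (fun u => J u j) u (F u) = g j u * J u j)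
    (hneg : ∀ j, ∫ t in (0 : ℝ)..T, g j (γ t) < 0) :
    ∃ q, 0 < q ∧ q < 1 ∧ ∃ ρ > 0, ∀ x : ℝ → E, IsIntegralCurve x (fun _ => F) → ∀ a,
      infDist (x a) (range γ) < ρ → ‖J (x (a + T))‖ ≤ q * ‖J (x a)‖ := by
  -- a common rate `c`, half of which is given up to the error in the multipliers
  obtain ⟨c, hcneg, hc⟩ : ∃ c : ℝ, (∀ j, ∫ t in (0 : ℝ)..T, g j (γ t) < -(2 * c)) ∧ 0 < c := by
    have h1 : ∀ᶠ c : ℝ in 𝓝[>] 0, ∀ j, ∫ t in (0 : ℝ)..T, g j (γ t) < -(2 * c) := by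
      refine eventually_all.2 fun j => ?_
      have : Tendsto (fun c : ℝ => -(2 * c)) (𝓝[>] 0) (𝓝 (-(2 * 0))) :=
        (Continuous.tendsto (by fun_prop) 0).mono_left nhdsWithin_le_nhds
      exact this.eventually_const_lt (by simpa using hneg j)
    exact (h1.and self_mem_nhdsWithin).exists
  choose ρ hρ h using fun j =>
    exists_eq_mul_exp_period hF hγ hT hp hN hγN (hJ j) (hg j) (hJg j) hc
  obtain ⟨ρ₀, hρ₀, hρ₀pos⟩ : ∃ ρ₀ : ℝ, (∀ j, ρ₀ < ρ j) ∧ 0 < ρ₀ := by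
    have h1 : ∀ᶠ r : ℝ in 𝓝[>] 0, ∀ j, r < ρ j :=
      eventually_all.2 fun j => (eventually_lt_nhds (hρ j)).filter_mono nhdsWithin_le_nhds
    exact (h1.and self_mem_nhdsWithin).exists
  refine ⟨Real.exp (-c), Real.exp_pos _, by rw [Real.exp_lt_one_iff]; linarith, ρ₀, hρ₀pos,
    fun x hx a ha => ?_⟩
  rw [pi_norm_le_iff_of_nonneg (by positivity)]
  intro j
  obtain ⟨r, hr, hJr⟩ := h j x hx a (ha.trans (hρ₀ j))
  rw [hJr, norm_mul, mul_comm, Real.norm_of_nonneg (Real.exp_pos r).le]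
  have h1 : r ≤ -c := by linarith [(abs_le.1 hr).2, hcneg j]
  gcongr
  exact norm_le_pi_norm _ j

end Lipschitz

/-! ### Stability from contraction over one period -/

section Stability

open Set Metric Filter

variable {E : Type*} [NormedAddCommGroup E] [NormedSpace ℝ E] {F : E → E} {K : NNReal}
  {γ : ℝ → E} {T : ℝ}

theorem exists_infDist_lt_of_continuousOn {α β : Type*} [PseudoMetricSpace α]
    [SeminormedAddCommGroup β] {Γ N : Set α} (hΓ : IsCompact Γ) (hN : IsOpen N) (hΓN : Γ ⊆ N)
    (hne : Γ.Nonempty) {J : α → β} (hJ : ContinuousOn J N) (hJ0 : ∀ p ∈ Γ, J p = 0)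
    {ε : ℝ} (hε : 0 < ε) : ∃ δ > 0, ∀ u, infDist u Γ < δ → u ∈ N ∧ ‖J u‖ < ε := by
  have hO : IsOpen (N ∩ J ⁻¹' ball 0 ε) := hJ.isOpen_inter_preimage hN isOpen_ball
  obtain ⟨δ, hδ, h⟩ := hΓ.exists_thickening_subset_open hO fun p hp =>
    ⟨hΓN hp, by simpa [hJ0 p hp] using hε⟩
  refine ⟨δ, hδ, fun u hu => ?_⟩
  have := h ((mem_thickening_iff_infDist_lt hne).2 hu)
  exact ⟨this.1, by simpa using this.2⟩

/-- If `J` measures the distance to the orbit and contracts over each period, then the distance to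
the orbit at times `nT` decays geometrically, and stays as small as required. -/
theorem exists_infDist_nat_mul_lt (hF : LipschitzWith K F)
    (hγ : IsIntegralCurve γ fun _ => F) (hT : 0 < T) (hp : Function.Periodic γ T)
    {G : Type*} [NormedAddCommGroup G] {N : Set E} (hN : IsOpen N) (hγN : range γ ⊆ N)
    {J : E → G} (hJ : ContinuousOn J N) (hJ0 : ∀ p ∈ range γ, J p = 0)
    {C : ℝ} (hC : 0 < C) (hdist : ∀ u ∈ N, infDist u (range γ) ≤ C * ‖J u‖)
    {q ρ : ℝ} (hq0 : 0 < q) (hq1 : q < 1) (hρ : 0 < ρ)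
    (hq : ∀ x : ℝ → E, IsIntegralCurve x (fun _ => F) → ∀ a, infDist (x a) (range γ) < ρ →
      ‖J (x (a + T))‖ ≤ q * ‖J (x a)‖) {ε : ℝ} (hε : 0 < ε) :
    ∃ δ > 0, ∃ B, ∀ x : ℝ → E, IsIntegralCurve x (fun _ => F) →
      infDist (x 0) (range γ) < δ → ∀ n : ℕ, infDist (x (n * T)) (range γ) < ε ∧
        infDist (x (n * T)) (range γ) ≤ B * q ^ n := by
  have hcomp := isCompact_range_of_periodic hγ.continuous hT hp
  obtain ⟨r, hr, hrN⟩ := hcomp.exists_thickening_subset_open hN hγN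
  set M := Real.exp (K * T)
  have hM : 0 < M := Real.exp_pos _
  -- `ρ` for the contraction over the next period, `r / M` for not leaving `N` during it
  set ε' := min ε (min ρ (r / M))
  have hε' : 0 < ε' := lt_min hε (lt_min hρ (div_pos hr hM))
  obtain ⟨δ, hδ, hδJ⟩ := exists_infDist_lt_of_continuousOn hcomp hN hγN (range_nonempty γ) hJ hJ0
    (div_pos hε' hC)
  refine ⟨min δ ε', lt_min hδ hε', ε', fun x hx hx0 => ?_⟩
  obtain ⟨hx0N, hJx0⟩ := hδJ (x 0) (hx0.trans_le (min_le_left _ _))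
  have key : ∀ n : ℕ, x (n * T) ∈ N ∧ infDist (x (n * T)) (range γ) < ε' ∧
      ‖J (x (n * T))‖ ≤ q ^ n * (ε' / C) := by
    intro n
    induction n with
    | zero => simpa [hx0N] using ⟨hx0.trans_le (min_le_right _ _), hJx0.le⟩
    | succ n ih =>
      obtain ⟨_, h2, h3⟩ := ih
      have hs : ((n + 1 : ℕ) : ℝ) * T = n * T + T := by push_cast; ring
      have hmem : x (n * T + T) ∈ N := by
        refine hrN ((mem_thickening_iff_infDist_lt (range_nonempty γ)).2 ?_)
        refine (infDist_le_infDist_mul_exp hF hγ hT hp hx (a := n * T) (by linarith)).trans_lt ?_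
        rw [add_sub_cancel_left, ← lt_div_iff₀ hM]
        exact h2.trans_le ((min_le_right _ _).trans (min_le_right _ _))
      have h4 : ‖J (x (n * T + T))‖ ≤ q ^ (n + 1) * (ε' / C) := by
        refine (hq x hx _ (h2.trans_le ((min_le_right _ _).trans (min_le_left _ _)))).trans ?_
        rw [pow_succ', mul_assoc]
        gcongr
      rw [hs]
      refine ⟨hmem, (hdist _ hmem).trans_lt ?_, h4⟩
      have h5 : q ^ (n + 1) < 1 := pow_lt_one₀ hq0.le hq1 (Nat.succ_ne_zero n)
      calc C * ‖J (x (n * T + T))‖ ≤ C * (q ^ (n + 1) * (ε' / C)) := by gcongr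
        _ = q ^ (n + 1) * ε' := by field_simp
        _ < 1 * ε' := by gcongr
        _ = ε' := one_mul _
  intro n
  obtain ⟨h1, h2, h3⟩ := key n
  refine ⟨h2.trans_le (min_le_left _ _), (hdist _ h1).trans ?_⟩
  calc C * ‖J (x (n * T))‖ ≤ C * (q ^ n * (ε' / C)) := by gcongr
    _ = ε' * q ^ n := by field_simp

/-- Each `t ≥ 0` lies in a period `[nT, (n + 1)T]`. -/
theorem floor_mul_le_and_sub_le (hT : 0 < T) {t : ℝ} (ht : 0 ≤ t) :
    (⌊t / T⌋₊ : ℝ) * T ≤ t ∧ t - ⌊t / T⌋₊ * T ≤ T := by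
  have h1 := Nat.floor_le (div_nonneg ht hT.le)
  have h2 := (Nat.lt_floor_add_one (t / T)).le
  rw [le_div_iff₀ hT] at h1
  rw [div_le_iff₀ hT] at h2
  exact ⟨h1, by linarith⟩

/-- The points of the orbit nearest to a solution at times `nT` form a Cauchy sequence, and their
limit is the asymptotic phase. -/
theorem exists_tendsto_dist_of_geometric (hF : LipschitzWith K F)
    (hγ : IsIntegralCurve γ fun _ => F) (hT : 0 < T) (hp : Function.Periodic γ T)
    {x : ℝ → E} (hx : IsIntegralCurve x fun _ => F) {q B : ℝ} (hq0 : 0 < q) (hq1 : q < 1)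
    (hxB : ∀ n : ℕ, infDist (x (n * T)) (range γ) ≤ B * q ^ n) :
    ∃ θ : ℝ, Tendsto (fun t => dist (x t) (γ (t + θ))) atTop (𝓝 0) := by
  set M := Real.exp (K * T)
  have hM : 0 < M := Real.exp_pos _
  choose s hs using fun n : ℕ => exists_dist_le_infDist_mul_exp hF hγ hT hp hx (n * T)
  have hs0 : ∀ n : ℕ, dist (x (n * T)) (γ (s n)) ≤ B * q ^ n := fun n => by
    have := hs n (n * T) le_rfl
    simp only [sub_self, zero_add, mul_zero, Real.exp_zero, mul_one] at this
    exact this.trans (hxB n)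
  have hcauchy : CauchySeq fun n => γ (s n) := by
    refine cauchySeq_of_le_geometric q (M * B + B * q) hq1 fun n => ?_
    have e : (n : ℝ) * T + T = ((n + 1 : ℕ) : ℝ) * T := by push_cast; ring
    have h1 := hs n (n * T + T) (by linarith)
    rw [add_sub_cancel_left, add_comm T, hp, e] at h1
    have h2 := hs0 (n + 1)
    calc dist (γ (s n)) (γ (s (n + 1))) ≤ dist (x ((n + 1 : ℕ) * T)) (γ (s n)) +
          dist (x ((n + 1 : ℕ) * T)) (γ (s (n + 1))) := dist_triangle_left _ _ _
      _ ≤ B * q ^ n * M + B * q ^ (n + 1) := by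
          refine add_le_add (h1.trans ?_) h2
          exact mul_le_mul_of_nonneg_right (hxB n) hM.le
      _ = (M * B + B * q) * q ^ n := by ring
  have hcomp := isCompact_range_of_periodic hγ.continuous hT hp
  obtain ⟨_, ⟨θ, rfl⟩, hθ⟩ := cauchySeq_tendsto_of_isComplete hcomp.isComplete
    (fun n => mem_range_self _) hcauchy
  have hxθ : Tendsto (fun n : ℕ => dist (x (n * T)) (γ θ)) atTop (𝓝 0) := by
    have h1 : Tendsto (fun n : ℕ => B * q ^ n + dist (γ (s n)) (γ θ)) atTop (𝓝 0) := by
      simpa using ((tendsto_pow_atTop_nhds_zero_of_lt_one hq0.le hq1).const_mul B).add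
        (tendsto_iff_dist_tendsto_zero.1 hθ)
    refine squeeze_zero (fun _ => dist_nonneg) (fun n => ?_) h1
    exact (dist_triangle _ (γ (s n)) _).trans (add_le_add_left (hs0 n) _)
  refine ⟨θ, ?_⟩
  have hy : IsIntegralCurve (fun t => γ (t + θ)) fun _ => F := fun t => by
    simpa [Function.comp_def] using (hγ (t + θ)).scomp t ((hasDerivAt_id t).add_const θ)
  have hfl : Tendsto (fun t : ℝ => ⌊t / T⌋₊) atTop atTop :=
    tendsto_nat_floor_atTop.comp (tendsto_id.atTop_div_const hT)
  have h2 := (hxθ.comp hfl).mul_const M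
  rw [zero_mul] at h2
  refine squeeze_zero' (Eventually.of_forall fun _ => dist_nonneg) ?_ h2
  filter_upwards [eventually_ge_atTop 0] with t ht
  obtain ⟨h3, h4⟩ := floor_mul_le_and_sub_le hT ht
  refine (dist_le_mul_exp_of_isIntegralCurve hF hx hy h3).trans ?_
  have h5 : γ ((⌊t / T⌋₊ : ℝ) * T + θ) = γ θ := by
    rw [add_comm]; exact hp.nat_mul _ _
  simp only [h5, Function.comp_apply]
  simp only [M]
  gcongr

/-- Between the times `nT` the distance to the orbit grows at most by the Grönwall factor. -/
theorem infDist_lt_of_nat_mul (hF : LipschitzWith K F)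
    (hγ : IsIntegralCurve γ fun _ => F) (hT : 0 < T) (hp : Function.Periodic γ T)
    {x : ℝ → E} (hx : IsIntegralCurve x fun _ => F) {ε : ℝ}
    (h : ∀ n : ℕ, infDist (x (n * T)) (range γ) < ε / Real.exp (K * T)) {t : ℝ} (ht : 0 ≤ t) :
    infDist (x t) (range γ) < ε := by
  obtain ⟨h3, h4⟩ := floor_mul_le_and_sub_le hT ht
  refine (infDist_le_infDist_mul_exp hF hγ hT hp hx h3).trans_lt ?_
  refine lt_of_le_of_lt ?_ ((lt_div_iff₀ (Real.exp_pos _)).1 (h ⌊t / T⌋₊))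
  have := infDist_nonneg (x := x (⌊t / T⌋₊ * T)) (s := range γ)
  gcongr

/-- If `J` expands over each period, a solution that stays near the orbit has `J = 0`. -/
theorem exists_eq_zero_of_infDist_lt (hγ : Continuous γ) (hT : 0 < T)
    (hp : Function.Periodic γ T) {N : Set E} (hN : IsOpen N) (hγN : range γ ⊆ N)
    {J : E → ℝ} (hJ : ContinuousOn J N) (hJ0 : ∀ p ∈ range γ, J p = 0)
    {q ρ : ℝ} (hq1 : 1 < q) (hρ : 0 < ρ)
    (hq : ∀ x : ℝ → E, IsIntegralCurve x (fun _ => F) → ∀ a, infDist (x a) (range γ) < ρ →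
      q * ‖J (x a)‖ ≤ ‖J (x (a + T))‖) :
    ∃ ε > 0, ∀ x : ℝ → E, IsIntegralCurve x (fun _ => F) →
      (∀ t ≥ 0, infDist (x t) (range γ) < ε) → J (x 0) = 0 := by
  have hcomp := isCompact_range_of_periodic hγ hT hp
  obtain ⟨δ, hδ, hδJ⟩ := exists_infDist_lt_of_continuousOn hcomp hN hγN (range_nonempty γ) hJ hJ0
    one_pos
  refine ⟨min ρ δ, lt_min hρ hδ, fun x hx hxε => ?_⟩
  by_contra hne
  have key : ∀ n : ℕ, q ^ n * ‖J (x 0)‖ ≤ ‖J (x (n * T))‖ := by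
    intro n
    induction n with
    | zero => simp
    | succ n ih =>
      have hs : ((n + 1 : ℕ) : ℝ) * T = n * T + T := by push_cast; ring
      rw [hs, pow_succ', mul_assoc]
      refine (mul_le_mul_of_nonneg_left ih (by linarith)).trans (hq x hx _ ?_)
      exact (hxε _ (by positivity)).trans_le (min_le_left _ _)
  obtain ⟨n, hn⟩ := pow_unbounded_of_one_lt (1 / ‖J (x 0)‖) hq1
  rw [div_lt_iff₀ (norm_pos_iff.2 hne)] at hn
  exact absurd ((hn.trans_le (key n)).trans
    (hδJ _ ((hxε (n * T) (by positivity)).trans_le (min_le_right _ _))).2) (lt_irrefl _)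

end Stability

/-! ### The first integrals measure the distance to the orbit -/

section Transversal

open Set Metric Filter

/-- A map with injective strict derivative is expanding near the point. -/
theorem exists_dist_le_mul_dist_of_injective {E G : Type*} [NormedAddCommGroup E]
    [NormedSpace ℝ E] [FiniteDimensional ℝ E] [NormedAddCommGroup G] [NormedSpace ℝ G]
    {f : E → G} {f' : E →L[ℝ] G} {p : E} (hf : HasStrictFDerivAt f f' p)
    (hinj : ∀ w, f' w = 0 → w = 0) :
    ∃ C > 0, ∃ r > 0, ∀ a ∈ ball p r, ∀ b ∈ ball p r, dist a b ≤ C * dist (f a) (f b) := by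
  obtain ⟨K, hK, hanti⟩ := (f' : E →ₗ[ℝ] G).exists_antilipschitzWith
    (LinearMap.ker_eq_bot'.2 hinj)
  have hK' : (0 : ℝ) < K := hK
  have ho := hf.isLittleO.def (c := 1 / (2 * K)) (by positivity)
  rw [nhds_prod_eq, Filter.Eventually, mem_prod_same_iff] at ho
  obtain ⟨s, hs, hsf⟩ := ho
  obtain ⟨r, hr, hrs⟩ := Metric.mem_nhds_iff.1 hs
  refine ⟨2 * K, by positivity, r, hr, fun a ha b hb => ?_⟩
  have h1 : ‖f a - f b - f' (a - b)‖ ≤ 1 / (2 * K) * ‖a - b‖ :=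
    hsf (mk_mem_prod (hrs ha) (hrs hb))
  have h2 : ‖a - b‖ ≤ K * ‖f' (a - b)‖ := by
    have := hanti.le_mul_dist (a - b) 0
    simpa using this
  have h3 : ‖f' (a - b)‖ ≤ ‖f a - f b‖ + 1 / (2 * K) * ‖a - b‖ := by
    have := norm_sub_le (f a - f b) (f a - f b - f' (a - b))
    rw [sub_sub_cancel] at this
    exact this.trans (by gcongr)
  rw [dist_eq_norm, dist_eq_norm]
  have h4 : (K : ℝ) * (‖f a - f b‖ + 1 / (2 * K) * ‖a - b‖) =
      K * ‖f a - f b‖ + ‖a - b‖ / 2 := by field_simp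
  have h5 := h2.trans (mul_le_mul_of_nonneg_left h3 hK'.le)
  rw [h4] at h5
  linarith

theorem inner_grads {n m : ℕ} (I : Euc n → Euc m) (u w : Euc n) (j : Fin m) :
    ⟪grads I u j, w⟫ = fderiv ℝ (fun x => I x j) u w :=
  InnerProductSpace.toDual_symm_apply

/-- A function with positive derivative at `t₀` takes near `t₀` all values close to `φ t₀`; the
derivative need not be continuous. -/
theorem eventually_exists_eq_of_deriv_pos {φ : ℝ → ℝ} (hc : Continuous φ) {φ' t₀ : ℝ}
    (hd : HasDerivAt φ φ' t₀) (hpos : 0 < φ') {S : Set ℝ} (hS : S ∈ 𝓝 t₀) :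
    ∀ᶠ y in 𝓝 (φ t₀), ∃ s ∈ S, φ s = y := by
  obtain ⟨η, hη, hηS⟩ := Metric.nhds_basis_closedBall.mem_iff.1 hS
  rw [Real.closedBall_eq_Icc] at hηS
  have hslope : ∀ᶠ s in 𝓝[≠] t₀, 0 < slope φ t₀ s :=
    (hasDerivAt_iff_tendsto_slope.1 hd).eventually_const_lt hpos
  rw [eventually_nhdsWithin_iff, Metric.eventually_nhds_iff] at hslope
  obtain ⟨κ, hκ, hslope⟩ := hslope
  set c := min η (κ / 2)
  have hc0 : 0 < c := lt_min hη (by positivity)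
  have hcκ : c < κ := (min_le_right _ _).trans_lt (by linarith)
  have h1 := hslope (y := t₀ + c) (by simpa [abs_of_pos hc0] using hcκ) (by simp [hc0.ne'])
  have h2 := hslope (y := t₀ - c) (by simpa [Real.dist_eq, abs_of_pos hc0] using hcκ)
    (by simp [hc0.ne'])
  rw [slope_def_field, add_sub_cancel_left] at h1
  rw [slope_def_field, sub_sub_cancel_left, div_neg, ← neg_div, neg_sub] at h2
  have h1' := (div_pos_iff_of_pos_right hc0).1 h1
  have h2' := (div_pos_iff_of_pos_right hc0).1 h2
  have hmem : Ioo (φ (t₀ - c)) (φ (t₀ + c)) ∈ 𝓝 (φ t₀) :=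
    Ioo_mem_nhds (by linarith) (by linarith)
  filter_upwards [hmem] with y hy
  obtain ⟨s, hs, rfl⟩ := intermediate_value_Icc (by linarith : t₀ - c ≤ t₀ + c) hc.continuousOn
    (Ioo_subset_Icc_self hy)
  exact ⟨s, hηS ⟨by linarith [hs.1, min_le_left η (κ / 2)],
    by linarith [hs.2, min_le_left η (κ / 2)]⟩, rfl⟩

/-- Near a point of the orbit where the gradients and the vector field are independent, the first
integrals control the distance to the orbit. The map `u ↦ (I u, ⟪ξ, u⟫)`, where `ξ` is the
velocity at `p = γ t₀`, is expanding near `p`, and the orbit contains a point with the same last coordinate as `u`. -/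
theorem eventually_infDist_le_mul_norm {m : ℕ} {I : Euc (m + 1) → Euc m} {γ : ℝ → Euc (m + 1)}
    (hγ : Continuous γ) {t₀ : ℝ} {ξ : Euc (m + 1)} (hd : HasDerivAt γ ξ t₀)
    (hI : ContDiffAt ℝ 1 I (γ t₀)) (hI0 : ∀ t, I (γ t) = 0)
    (hli : LinearIndependent ℝ (Fin.snoc (grads I (γ t₀)) ξ : Fin (m + 1) → Euc (m + 1))) :
    ∃ C > 0, ∀ᶠ u in 𝓝 (γ t₀), infDist u (range γ) ≤ C * ‖(fun j => I u j : Fin m → ℝ)‖ := by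
  set p := γ t₀
  have hξ : ξ ≠ 0 := by simpa using hli.ne_zero (Fin.last m)
  let f : Euc (m + 1) → (Fin m → ℝ) × ℝ := fun u => (fun j => I u j, ⟪ξ, u⟫)
  let f' : Euc (m + 1) →L[ℝ] (Fin m → ℝ) × ℝ :=
    (ContinuousLinearMap.pi fun j => fderiv ℝ (fun x => I x j) p).prod (innerSL ℝ ξ)
  have hf : HasStrictFDerivAt f f' p := by
    refine HasStrictFDerivAt.prodMk (hasStrictFDerivAt_pi.2 fun j => ?_)
      (innerSL ℝ ξ).hasStrictFDerivAt
    exact ((contDiffAt_piLp 2).1 hI j).hasStrictFDerivAt one_ne_zero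
  have hinj : ∀ w, f' w = 0 → w = 0 := by
    intro w hw
    have hw1 : ∀ j, ⟪grads I p j, w⟫ = 0 := fun j => by
      rw [inner_grads]; exact congrFun (congrArg Prod.fst hw) j
    have hw2 : ⟪ξ, w⟫ = 0 := congrArg Prod.snd hw
    have hspan := hli.span_eq_top_of_card_eq_finrank' (by simp)
    have hle : Submodule.span ℝ (range (Fin.snoc (grads I p) ξ : Fin (m + 1) → Euc (m + 1))) ≤
        LinearMap.ker (innerₗ (Euc (m + 1)) w) := by
      rw [Submodule.span_le]
      rintro _ ⟨j, rfl⟩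
      rw [SetLike.mem_coe, LinearMap.mem_ker, innerₗ_apply_apply, real_inner_comm]
      induction j using Fin.lastCases with
      | last => simpa using hw2
      | cast j => simpa using hw1 j
    rw [hspan] at hle
    simpa using hle (Submodule.mem_top (x := w))
  obtain ⟨C, hC, r, hr, hexp⟩ := exists_dist_le_mul_dist_of_injective hf hinj
  refine ⟨C, hC, ?_⟩
  have hS : γ ⁻¹' ball p r ∈ 𝓝 t₀ := hγ.continuousAt.preimage_mem_nhds (ball_mem_nhds p hr)
  have hφ : HasDerivAt (fun s => ⟪ξ, γ s⟫) ⟪ξ, ξ⟫ t₀ := by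
    simpa [Function.comp_def] using (innerSL ℝ ξ).hasFDerivAt.comp_hasDerivAt t₀ hd
  have hivt := eventually_exists_eq_of_deriv_pos (by fun_prop) hφ
    (real_inner_self_pos.2 hξ) hS
  have hcont : Tendsto (fun u : Euc (m + 1) => ⟪ξ, u⟫) (𝓝 p) (𝓝 ⟪ξ, p⟫) :=
    Continuous.tendsto (by fun_prop) p
  filter_upwards [hcont.eventually hivt, ball_mem_nhds p hr] with u ⟨s, hs, hsu⟩ hur
  calc infDist u (range γ) ≤ dist u (γ s) := infDist_le_dist_of_mem (mem_range_self s)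
    _ ≤ C * dist (f u) (f (γ s)) := hexp u hur _ hs
    _ = C * ‖(fun j => I u j : Fin m → ℝ)‖ := by
        have e : f (γ s) = (0, ⟪ξ, u⟫) := by
          simp only [f, hI0 s, hsu]; rfl
        rw [e, Prod.dist_eq, dist_self, dist_zero_right, max_eq_left (norm_nonneg _)]

/-- The first integrals control the distance to the orbit in a neighbourhood of the whole orbit. -/
theorem exists_nhds_infDist_le_mul_norm {m : ℕ} {I : Euc (m + 1) → Euc m}
    {γ : ℝ → Euc (m + 1)} {X : Euc (m + 1) → Euc (m + 1)} (hγ : IsIntegralCurve γ fun _ => X)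
    (hcomp : IsCompact (range γ)) (hI : ∀ t, ContDiffAt ℝ 1 I (γ t)) (hI0 : ∀ t, I (γ t) = 0)
    (hli : ∀ t, LinearIndependent ℝ
      (Fin.snoc (grads I (γ t)) (X (γ t)) : Fin (m + 1) → Euc (m + 1))) :
    ∃ N, IsOpen N ∧ range γ ⊆ N ∧ ∃ C > 0, ∀ u ∈ N,
      infDist u (range γ) ≤ C * ‖(fun j => I u j : Fin m → ℝ)‖ := by
  have key : ∃ C > 0, ∀ᶠ u in 𝓝ˢ (range γ),
      infDist u (range γ) ≤ C * ‖(fun j => I u j : Fin m → ℝ)‖ := by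
    refine hcomp.induction_on (p := fun S => ∃ C > 0, ∀ᶠ u in 𝓝ˢ S,
      infDist u (range γ) ≤ C * ‖(fun j => I u j : Fin m → ℝ)‖) ⟨1, one_pos, by simp⟩ ?_ ?_ ?_
    · rintro S S' hSS' ⟨C, hC, h⟩
      exact ⟨C, hC, h.filter_mono (nhdsSet_mono hSS')⟩
    · rintro S S' ⟨C, hC, h⟩ ⟨C', hC', h'⟩
      refine ⟨max C C', lt_max_of_lt_left hC, ?_⟩
      rw [nhdsSet_union, eventually_sup]
      constructor
      · filter_upwards [h] with u hu
        exact hu.trans (mul_le_mul_of_nonneg_right (le_max_left _ _) (norm_nonneg _))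
      · filter_upwards [h'] with u hu
        exact hu.trans (mul_le_mul_of_nonneg_right (le_max_right _ _) (norm_nonneg _))
    · rintro _ ⟨t, rfl⟩
      obtain ⟨C, hC, h⟩ := eventually_infDist_le_mul_norm hγ.continuous (hγ t) (hI t) hI0 (hli t)
      obtain ⟨O, hO, hOo, htO⟩ := _root_.eventually_nhds_iff.1 h
      refine ⟨O, mem_nhdsWithin_of_mem_nhds (hOo.mem_nhds htO), C, hC, ?_⟩
      rw [hOo.nhdsSet_eq]
      exact hO
  obtain ⟨C, hC, h⟩ := key
  obtain ⟨N, hN, hγN, hNC⟩ := eventually_nhdsSet_iff_exists.1 h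
  exact ⟨N, hN, hγN, C, hC, hNC⟩

end Transversal

/-! ### Truncation of the vector field -/

section Truncation

open Set Metric Filter

variable {E : Type*} [NormedAddCommGroup E] [NormedSpace ℝ E] [FiniteDimensional ℝ E]

/-- A smooth vector field on an open set agrees, near a compact subset, with a bounded and globally
Lipschitz vector field. -/
theorem exists_lipschitzWith_eqOn {Y : E → E} {V Γ : Set E} (hV : IsOpen V)
    (hY : ContDiffOn ℝ ∞ Y V) (hΓ : IsCompact Γ) (hΓV : Γ ⊆ V) :
    ∃ (F : E → E) (K L : NNReal) (N : Set E), LipschitzWith K F ∧ (∀ u, ‖F u‖ ≤ L) ∧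
      IsOpen N ∧ Γ ⊆ N ∧ N ⊆ V ∧ EqOn F Y N := by
  have : ProperSpace E := FiniteDimensional.proper_real E
  obtain ⟨δ, hδ, hδV⟩ := hΓ.exists_cthickening_subset_open hV hΓV
  obtain ⟨χ, hχ1, hχ0, -⟩ := exists_contMDiffMap_one_nhds_of_subset_interior
    (n := ⊤) (modelWithCornersSelf ℝ E) hΓ.isClosed
    (t := cthickening δ Γ)
    ((self_subset_thickening hδ Γ).trans
      (interior_maximal (thickening_subset_cthickening δ Γ) isOpen_thickening))
  have hχ : ContDiff ℝ ∞ χ := χ.contMDiff.contDiff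
  have hF : ContDiff ℝ ∞ fun u => χ u • Y u := by
    rw [contDiff_iff_contDiffAt]
    intro u
    by_cases hu : u ∈ V
    · exact hχ.contDiffAt.smul (hY.contDiffAt (hV.mem_nhds hu))
    · have h0 : ∀ᶠ w in 𝓝 u, χ w • Y w = 0 := by
        filter_upwards [isClosed_cthickening.isOpen_compl.mem_nhds fun h => hu (hδV h)] with w hw
        rw [hχ0 w hw, zero_smul]
      exact contDiffAt_const.congr_of_eventuallyEq h0
  have hsupp : HasCompactSupport fun u => χ u • Y u :=
    HasCompactSupport.intro hΓ.cthickening fun u hu => by rw [hχ0 u hu, zero_smul]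
  obtain ⟨K, hK⟩ := ContDiff.lipschitzWith_of_hasCompactSupport hsupp hF (by simp)
  obtain ⟨L, hL⟩ := hsupp.exists_bound_of_continuous hF.continuous
  obtain ⟨N, hN, hΓN, hN1⟩ := eventually_nhdsSet_iff_exists.1 hχ1
  refine ⟨_, K, L.toNNReal, N ∩ V, hK, fun u => (hL u).trans (Real.le_coe_toNNReal L),
    hN.inter hV, subset_inter hΓN hΓV, inter_subset_right, fun u hu => ?_⟩
  simp only [hN1 u hu.1, one_smul]

end Truncation

/-! ### Solutions near the orbit do not see the truncation -/

section Forward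

open Set Metric Filter

variable {n : ℕ} {Y F : Euc n → Euc n} {V N Γ : Set (Euc n)} {K : NNReal} {ε : ℝ}

theorem IsForwardSolution.hasDerivWithinAt {x₀ : Euc n} {x : ℝ → Euc n}
    (hx : IsForwardSolution Y V x₀ x) {t : ℝ} (ht : 0 ≤ t) :
    HasDerivWithinAt x (Y (x t)) (Ici t) t :=
  (hx.sol t ht).mono (Ici_subset_Ici.2 ht)

/-- A solution that stays where `Y` agrees with the Lipschitz field `F` is a solution of `F`. -/
theorem IsForwardSolution.eqOn_of_mem (hF : LipschitzWith K F) (hFY : EqOn F Y N)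
    {x₀ : Euc n} {x y : ℝ → Euc n} (hx : IsForwardSolution Y V x₀ x)
    (hy : IsIntegralCurve y fun _ => F) (hy0 : y 0 = x₀) (hxN : ∀ t, 0 ≤ t → x t ∈ N) :
    EqOn x y (Ici 0) := fun t ht => by
  refine eqOn_Icc_of_hasDerivWithinAt hF (b := t) (hx.sol.continuousOn.mono Icc_subset_Ici_self)
    (fun s hs => ?_) hy (by rw [hx.init, hy0]) ⟨ht, le_rfl⟩
  rw [hFY (hxN s hs.1)]
  exact hx.hasDerivWithinAt hs.1

/-- If the solution of the Lipschitz field `F` stays near `Γ`, where `F = Y`, then every solution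
of `Y` with the same initial value coincides with it: there is no first time at which it could
leave the neighbourhood. -/
theorem IsForwardSolution.eqOn_of_infDist_lt (hF : LipschitzWith K F) (hFY : EqOn F Y N)
    (hεN : ∀ u, infDist u Γ < ε → u ∈ N) {x₀ : Euc n} {x y : ℝ → Euc n}
    (hx : IsForwardSolution Y V x₀ x) (hy : IsIntegralCurve y fun _ => F) (hy0 : y 0 = x₀)
    (hyε : ∀ t, 0 ≤ t → infDist (y t) Γ < ε) : EqOn x y (Ici 0) := by
  refine hx.eqOn_of_mem hF hFY hy hy0 fun t ht => hεN _ ?_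
  by_contra! hge
  have hc : ContinuousOn (fun s => infDist (x s) Γ) (Icc 0 t) :=
    (continuous_infDist_pt Γ).comp_continuousOn (hx.sol.continuousOn.mono Icc_subset_Ici_self)
  have hcl : IsCompact (Icc 0 t ∩ (fun s => infDist (x s) Γ) ⁻¹' Ici ε) :=
    isCompact_Icc.of_isClosed_subset (hc.preimage_isClosed_of_isClosed isClosed_Icc isClosed_Ici)
      inter_subset_left
  obtain ⟨τ, ⟨hτ, hτε⟩, hleast⟩ := hcl.exists_isLeast ⟨t, ⟨ht, le_rfl⟩, hge⟩
  have heq := eqOn_Icc_of_hasDerivWithinAt hF (b := τ)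
    (hx.sol.continuousOn.mono Icc_subset_Ici_self) (fun s hs => ?_) hy (by rw [hx.init, hy0])
    ⟨hτ.1, le_rfl⟩
  · have : ε ≤ infDist (x τ) Γ := hτε
    rw [heq] at this
    exact absurd (hyε τ hτ.1) (not_lt.2 this)
  · have hs1 : infDist (x s) Γ < ε := by
      by_contra! hs2
      exact absurd (hleast ⟨⟨hs.1, hs.2.le.trans hτ.2⟩, hs2⟩) (not_le.2 hs.2)
    rw [hFY (hεN _ hs1)]
    exact hx.hasDerivWithinAt hs.1

theorem solutionHas_of_isIntegralCurve (hF : LipschitzWith K F) (hFY : EqOn F Y N) (hNV : N ⊆ V)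
    (hεN : ∀ u, infDist u Γ < ε → u ∈ N) {x₀ : Euc n} {y : ℝ → Euc n}
    (hy : IsIntegralCurve y fun _ => F) (hy0 : y 0 = x₀)
    (hyε : ∀ t, 0 ≤ t → infDist (y t) Γ < ε) {P : (ℝ → Euc n) → Prop}
    (hP : ∀ x, EqOn x y (Ici 0) → P x) : SolutionHas Y V x₀ P := by
  refine ⟨⟨y, hy0, fun t ht => hNV (hεN _ (hyε t ht)), fun t ht => ?_⟩,
    fun x hx => hP x (hx.eqOn_of_infDist_lt hF hFY hεN hy hy0 hyε)⟩
  have : HasDerivWithinAt y (F (y t)) (Ici 0) t := (hy t).hasDerivWithinAt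
  rwa [hFY (hεN _ (hyε t ht))] at this

end Forward

/-! ### The perturbed system near the periodic orbit -/

section Perturbed

open Set Metric Filter

theorem IsPeriodicOrbit.orbit_eq_range {n : ℕ} {Y : Euc n → Euc n} {V : Set (Euc n)}
    {γ : ℝ → Euc n} {T : ℝ} (h : IsPeriodicOrbit Y V γ T) : orbit γ T = range γ := by
  have := h.periodic.image_Icc h.pos 0
  rwa [zero_add] at this

theorem frequently_ne_zero_of_grads_ne_zero {n m : ℕ} {I : Euc n → Euc m} {p : Euc n} {j : Fin m}
    (h : grads I p j ≠ 0) : ∃ᶠ u in 𝓝 p, I u j ≠ 0 := by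
  intro hev
  refine h ?_
  have h0 : (fun u => I u j) =ᶠ[𝓝 p] fun _ => 0 := by
    filter_upwards [hev] with u hu using not_not.1 hu
  rw [grads, h0.gradient_eq]
  simp [gradient]

variable {m : ℕ} {V : Set (Euc (m + 1))} {Y : Euc (m + 1) → Euc (m + 1)}
  {I : Euc (m + 1) → Euc m} {γ : ℝ → Euc (m + 1)} {T : ℝ} {h : Fin m → Euc (m + 1) → ℝ}

/-- A periodic orbit in the common zero set of functions with `ℒ_Y Iⱼ = hⱼ Iⱼ` attracts all nearby
solutions, with asymptotic phase, if the integrals of the `hⱼ` over the period are negative. -/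
theorem orbitallyPhaseAsymptoticallyStable_of_integral_neg (hV : IsOpen V)
    (hY : ContDiffOn ℝ ∞ Y V) (hI : ContDiffOn ℝ ∞ I V) (hh : ∀ i, ContinuousOn (h i) V)
    (hIY : ∀ u ∈ V, ∀ j, ⟪grads I u j, Y u⟫ = h j u * I u j)
    (hγ : IsPeriodicOrbit Y V γ T) (hI0 : ∀ t, I (γ t) = 0)
    (hli : ∀ t, LinearIndependent ℝ
      (Fin.snoc (grads I (γ t)) (Y (γ t)) : Fin (m + 1) → Euc (m + 1)))
    (hneg : ∀ i, ∫ s in (0 : ℝ)..T, h i (γ s) < 0) :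
    OrbitallyPhaseAsymptoticallyStable Y V γ T := by
  have hcomp := isCompact_range_of_periodic hγ.sol.continuous hγ.pos hγ.periodic
  have hγV : range γ ⊆ V := range_subset_iff.2 hγ.mem
  have hIc : ∀ j, ContDiffOn ℝ ∞ (fun u => I u j) V := (contDiffOn_piLp 2).1 hI
  obtain ⟨F, K, L, N, hF, hL, hN, hγN, hNV, hFY⟩ := exists_lipschitzWith_eqOn hV hY hcomp hγV
  have hγF : IsIntegralCurve γ fun _ => F := fun t => by
    have h1 : HasDerivAt γ (Y (γ t)) t := hγ.sol t
    rwa [← hFY (hγN (mem_range_self t))] at h1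
  obtain ⟨N', hN', hγN', C, hC, hdist⟩ := exists_nhds_infDist_le_mul_norm hγ.sol hcomp
    (fun t => (hI.contDiffAt (hV.mem_nhds (hγ.mem t))).of_le (by simp)) hI0 hli
  have hJg : ∀ j, ∀ u ∈ N, fderiv ℝ (fun u => I u j) u (F u) = h j u * I u j :=
    fun j u hu => by rw [← inner_grads, hFY hu, hIY u (hNV hu) j]
  obtain ⟨q, hq0, hq1, ρ, hρ, hq⟩ := exists_norm_le_mul_norm_period (J := fun u j => I u j)
    hF hγF hγ.pos hγ.periodic hN hγN
    (fun j => ((hIc j).differentiableOn (by simp)).mono hNV)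
    (fun j => (hh j).mono hNV) hJg hneg
  have hJcont : ContinuousOn (fun u => fun j => I u j : Euc (m + 1) → Fin m → ℝ) (N ∩ N') :=
    continuousOn_pi.2 fun j => (hIc j).continuousOn.mono (inter_subset_left.trans hNV)
  obtain ⟨r, hr, hrN⟩ := hcomp.exists_thickening_subset_open hN hγN
  have hne := range_nonempty γ
  have key : ∀ ε > 0, ∃ δ > 0, ∀ x₀, infDist x₀ (range γ) < δ →
      ∃ y : ℝ → Euc (m + 1), IsIntegralCurve y (fun _ => F) ∧ y 0 = x₀ ∧
        (∀ t, 0 ≤ t → infDist (y t) (range γ) < ε) ∧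
        ∃ θ, Tendsto (fun t => dist (y t) (γ (t + θ))) atTop (𝓝 0) := by
    intro ε hε
    obtain ⟨δ, hδ, B, hB⟩ := exists_infDist_nat_mul_lt hF hγF hγ.pos hγ.periodic
      (hN.inter hN') (subset_inter hγN hγN') hJcont
      (by rintro _ ⟨t, rfl⟩; simp only [hI0 t]; rfl) hC (fun u hu => hdist u hu.2) hq0 hq1 hρ hq
      (div_pos hε (Real.exp_pos (K * T)))
    refine ⟨δ, hδ, fun x₀ hx₀ => ?_⟩
    obtain ⟨y, rfl, hy⟩ := exists_isIntegralCurve_of_lipschitzWith hF hL x₀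
    have hyB := hB y hy hx₀
    exact ⟨y, hy, rfl, fun t ht => infDist_lt_of_nat_mul hF hγF hγ.pos hγ.periodic hy
      (fun n => (hyB n).1) ht, exists_tendsto_dist_of_geometric hF hγF hγ.pos hγ.periodic hy hq0 hq1
      fun n => (hyB n).2⟩
  have hεN : ∀ ε ≤ r, ∀ u, infDist u (range γ) < ε → u ∈ N := fun ε hε u hu =>
    hrN ((mem_thickening_iff_infDist_lt hne).2 (hu.trans_le hε))
  rw [OrbitallyPhaseAsymptoticallyStable, OrbitallyAsymptoticallyStable, OrbitallyStable,
    hγ.orbit_eq_range]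
  obtain ⟨δ₀, hδ₀, hkey₀⟩ := key r hr
  have hphase : ∀ x₀ ∈ V, infDist x₀ (range γ) < δ₀ → SolutionHas Y V x₀
      (fun x => ∃ θ₀ : ℝ, Tendsto (fun t => dist (x t) (γ (t + θ₀))) atTop (𝓝 0)) := by
    intro x₀ _ hx₀
    obtain ⟨y, hy, hy0, hyr, θ, hθ⟩ := hkey₀ x₀ hx₀
    refine solutionHas_of_isIntegralCurve hF hFY hNV (hεN r le_rfl) hy hy0 hyr
      fun x hxy => ⟨θ, hθ.congr' ?_⟩
    filter_upwards [eventually_ge_atTop 0] with t ht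
    rw [hxy ht]
  refine ⟨⟨fun ε hε => ?_, δ₀, hδ₀, fun x₀ hx₀V hx₀ => ?_⟩, δ₀, hδ₀, hphase⟩
  · obtain ⟨δ, hδ, hkey⟩ := key (min ε r) (lt_min hε hr)
    refine ⟨δ, hδ, fun x₀ _ hx₀ => ?_⟩
    obtain ⟨y, hy, hy0, hyε, -⟩ := hkey x₀ hx₀
    refine solutionHas_of_isIntegralCurve hF hFY hNV (hεN _ (min_le_right ε r)) hy hy0 hyε
      fun x hxy t ht => ?_
    rw [hxy (mem_Ici.2 ht.le)]
    exact (hyε t ht.le).trans_le (min_le_left _ _)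
  · obtain ⟨hex, hall⟩ := hphase x₀ hx₀V hx₀
    refine ⟨hex, fun x hx => ?_⟩
    obtain ⟨θ, hθ⟩ := hall x hx
    exact squeeze_zero (fun _ => infDist_nonneg)
      (fun t => infDist_le_dist_of_mem (mem_range_self _)) hθ

/-- A periodic orbit in the zero set of a function with `ℒ_Y I_{i₀} = h_{i₀} I_{i₀}` and nonzero
gradient is unstable if the integral of `h_{i₀}` over the period is positive. -/
theorem unstable_of_integral_pos (hV : IsOpen V)
    (hY : ContDiffOn ℝ ∞ Y V) (hI : ContDiffOn ℝ ∞ I V) {i₀ : Fin m}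
    (hh : ContinuousOn (h i₀) V)
    (hIY : ∀ u ∈ V, ⟪grads I u i₀, Y u⟫ = h i₀ u * I u i₀)
    (hγ : IsPeriodicOrbit Y V γ T) (hI0 : ∀ t, I (γ t) = 0) (hgrad : grads I (γ 0) i₀ ≠ 0)
    (hpos : 0 < ∫ s in (0 : ℝ)..T, h i₀ (γ s)) :
    Unstable Y V (orbit γ T) := by
  have hcomp := isCompact_range_of_periodic hγ.sol.continuous hγ.pos hγ.periodic
  have hγV : range γ ⊆ V := range_subset_iff.2 hγ.mem
  have hIc : ContDiffOn ℝ ∞ (fun u => I u i₀) V := (contDiffOn_piLp 2).1 hI i₀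
  obtain ⟨F, K, L, N, hF, hL, hN, hγN, hNV, hFY⟩ := exists_lipschitzWith_eqOn hV hY hcomp hγV
  have hγF : IsIntegralCurve γ fun _ => F := fun t => by
    have h1 : HasDerivAt γ (Y (γ t)) t := hγ.sol t
    rwa [← hFY (hγN (mem_range_self t))] at h1
  have hJg : ∀ u ∈ N, fderiv ℝ (fun u => I u i₀) u (F u) = h i₀ u * I u i₀ :=
    fun u hu => by rw [← inner_grads, hFY hu, hIY u (hNV hu)]
  obtain ⟨ρ, hρ, hρJ⟩ := exists_eq_mul_exp_period hF hγF hγ.pos hγ.periodic hN hγN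
    ((hIc.differentiableOn (by simp)).mono hNV) (hh.mono hNV) hJg (half_pos hpos)
  set c := (∫ s in (0 : ℝ)..T, h i₀ (γ s)) / 2
  have hq : ∀ x : ℝ → Euc (m + 1), IsIntegralCurve x (fun _ => F) → ∀ a,
      infDist (x a) (range γ) < ρ → Real.exp c * ‖I (x a) i₀‖ ≤ ‖I (x (a + T)) i₀‖ := by
    intro x hx a ha
    obtain ⟨s, hs, hJs⟩ := hρJ x hx a ha
    rw [hJs, norm_mul, mul_comm, Real.norm_of_nonneg (Real.exp_pos s).le]
    have h1 : c ≤ s := by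
      have h2 : ∫ s in (0 : ℝ)..T, h i₀ (γ s) = 2 * c := by simp only [c]; ring
      linarith [(abs_le.1 hs).1]
    gcongr
  obtain ⟨ε, hε, hεJ⟩ := exists_eq_zero_of_infDist_lt hγ.sol.continuous hγ.pos hγ.periodic
    hN hγN (hIc.continuousOn.mono hNV) (by rintro _ ⟨t, rfl⟩; simp [hI0 t])
    (Real.one_lt_exp_iff.2 (half_pos hpos)) hρ hq
  obtain ⟨r, hr, hrN⟩ := hcomp.exists_thickening_subset_open hN hγN
  have hne := range_nonempty γ
  rw [Unstable, hγ.orbit_eq_range]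
  intro hstab
  obtain ⟨δ, hδ, hδs⟩ := hstab (min ε r) (lt_min hε hr)
  have hnear : ∀ᶠ u in 𝓝 (γ 0), infDist u (range γ) < min δ (min ε r) :=
    (continuous_infDist_pt (range γ)).continuousAt.eventually_lt_const (by
      simp only [infDist_zero_of_mem (mem_range_self (f := γ) 0)]
      exact lt_min hδ (lt_min hε hr))
  obtain ⟨x₀, hx₀I, hx₀, hx₀V⟩ := ((frequently_ne_zero_of_grads_ne_zero hgrad).and_eventually
    (hnear.and (hV.mem_nhds (hγ.mem 0)))).exists
  obtain ⟨⟨x, hx⟩, hall⟩ := hδs x₀ hx₀V (hx₀.trans_le (min_le_left _ _))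
  have hxε : ∀ t, 0 ≤ t → infDist (x t) (range γ) < min ε r := by
    intro t ht
    rcases ht.eq_or_lt with rfl | ht
    · rw [hx.init]; exact hx₀.trans_le (min_le_right _ _)
    · exact hall x hx t ht
  obtain ⟨y, hy0, hy⟩ := exists_isIntegralCurve_of_lipschitzWith hF hL x₀
  have hxy := hx.eqOn_of_mem hF hFY hy hy0 fun t ht => hrN
    ((mem_thickening_iff_infDist_lt hne).2 ((hxε t ht).trans_le (min_le_right _ _)))
  refine hx₀I ?_
  rw [← hy0]
  exact hεJ y hy fun t ht => by
    rw [← hxy (mem_Ici.2 ht)]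
    exact (hxε t ht).trans_le (min_le_left _ _)

end Perturbed

end PeriodicStab

open PeriodicStab in
theorem theorem3p3 {m : ℕ} (U V : Set (Euc (m + 1))) (hU : IsOpen U) (hV : IsOpen V) (hVU : V ⊆ U)
    (X : Euc (m + 1) → Euc (m + 1)) (hX : ContDiffOn ℝ ∞ X U)
    (I : Euc (m + 1) → Euc m) (hI : ContDiffOn ℝ ∞ I U)
    (hfirst : ∀ u ∈ U, ∀ j, ⟪grads I u j, X u⟫ = 0)
    (hrank : ∀ u ∈ V, LinearIndependent ℝ (grads I u))
    (γ : ℝ → Euc (m + 1)) (T : ℝ) (hγ : IsPeriodicOrbit X V γ T)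
    (hlevel : ∀ u ∈ orbit γ T, I u = 0)
    (hreg : IsRegularValueOn I V 0)
    (hindep : ∀ t ∈ Set.Icc 0 T,
      LinearIndependent ℝ (Fin.snoc (grads I (γ t)) (X (γ t)) : Fin (m + 1) → Euc (m + 1))) :
    (∀ h : Fin m → Euc (m + 1) → ℝ, (∀ i, ContDiffOn ℝ ∞ (h i) V) →
      (∀ u ∈ V, ∀ j, ⟪grads I u j, X u + perturbation I h u⟫ = h j u * I u j) ∧
      IsPeriodicOrbit (fun u => X u + perturbation I h u) V γ T) ∧
    (∀ h : Fin m → Euc (m + 1) → ℝ, (∀ i, ContDiffOn ℝ ∞ (h i) V) →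
      (∀ i, (∫ s in (0 : ℝ)..T, h i (γ s)) < 0) →
      OrbitallyPhaseAsymptoticallyStable (fun u => X u + perturbation I h u) V γ T) ∧
    (∀ k : Fin m → Euc (m + 1) → ℝ, (∀ i, ContDiffOn ℝ ∞ (k i) V) →
      (∃ i₀, 0 < ∫ s in (0 : ℝ)..T, k i₀ (γ s)) →
      Unstable (fun u => X u + perturbation I k u) V (orbit γ T)) := by
  have hI0 : ∀ t, I (γ t) = 0 := fun t =>
    hlevel _ (by rw [hγ.orbit_eq_range]; exact Set.mem_range_self t)
  have hIV := hI.mono hVU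
  have hXγ : ∀ (h : Fin m → Euc (m + 1) → ℝ) t, X (γ t) + perturbation I h (γ t) = X (γ t) :=
    fun h t => by rw [perturbation_eq_zero h (hI0 t), add_zero]
  have hli : ∀ t, LinearIndependent ℝ
      (Fin.snoc (grads I (γ t)) (X (γ t)) : Fin (m + 1) → Euc (m + 1)) := by
    intro t
    have hmem : γ t ∈ orbit γ T := by rw [hγ.orbit_eq_range]; exact Set.mem_range_self t
    obtain ⟨s, hs, hst⟩ := hmem
    rw [← hst]
    exact hindep s hs
  have hIY : ∀ (h : Fin m → Euc (m + 1) → ℝ), ∀ u ∈ V, ∀ j,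
      ⟪grads I u j, X u + perturbation I h u⟫ = h j u * I u j := fun h u hu j => by
    rw [inner_add_right, hfirst u (hVU hu) j, inner_grads_perturbation I h u (hrank u hu), zero_add]
  have hper : ∀ h : Fin m → Euc (m + 1) → ℝ,
      IsPeriodicOrbit (fun u => X u + perturbation I h u) V γ T := fun h =>
    ⟨hγ.pos, hγ.mem, fun t => (hγ.sol t).congr_deriv (hXγ h t).symm, hγ.periodic, hγ.nonconst⟩
  have hsmooth : ∀ h : Fin m → Euc (m + 1) → ℝ, (∀ i, ContDiffOn ℝ ∞ (h i) V) →
      ContDiffOn ℝ ∞ (fun u => X u + perturbation I h u) V := fun h hh =>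
    (hX.mono hVU).add (contDiffOn_perturbation hV hIV hrank hh)
  refine ⟨fun h _ => ⟨hIY h, hper h⟩, fun h hh hneg => ?_, fun k hk ⟨i₀, hpos⟩ => ?_⟩
  · exact orbitallyPhaseAsymptoticallyStable_of_integral_neg hV (hsmooth h hh) hIV
      (fun i => (hh i).continuousOn) (hIY h) (hper h) hI0
      (fun t => by simpa only [hXγ] using hli t) hneg
  · exact unstable_of_integral_pos hV (hsmooth k hk) hIV (hk i₀).continuousOn
      (fun u hu => hIY k u hu i₀) (hper k) hI0 ((hrank _ (hγ.mem 0)).ne_zero i₀) hpos
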